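/- Let $k\ge 1$ be an integer that is not a prime power (the value $k=1$ is allowed), let $q=2^k$, let $\varphi:x\mapsto x^2$ be the Frobenius automorphism of $\mathbb F_q$, and let $\Gamma L(2,q)=GL(2,q)\rtimes\langle\varphi\rangle=\{A\varphi^i: A\in GL(2,q),\ 0\le i\le k-1\}$ act on the set $\Omega$ of non-zero vectors of $\mathbb F_q^2$ by $(A\varphi^i)v=Av^{\varphi^i}$. Call $\mathcal F\subseteq \Gamma L(2,q)$ intersecting if for all $g,h\in\mathcal F$ there is $w\in\Omega$ with $g(w)=h(w)$. Then $\Gamma L(2,q)$ has the EKR property: every intersecting set has size at most that of the stabilizer of a point of $\Omega$. The largest size of an intersecting set is $kq(q-1)$. Let moreover $\omega$ be a primitive element of $\mathbb F_q$ and, for $0\le i,t\le q-2$ and $0\le j\le k-1$, let $$V_{i,j}=\left\{\omega^i\varphi^j\begin{bmatrix}1&z\\0&y\end{bmatrix}: z\in\mathbb F_q,\ y\in\mathbb F_q^*\right\},\qquad H_{t,j}=\left\{\varphi^j\begin{bmatrix}x&z\\0&\omega^t\end{bmatrix}: x\in\mathbb F_q^*,\ z\in\mathbb F_q\right\}.$$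 Let $\mathcal H_q$ be the subgroup of all $A\varphi^j$ with $A\in GL(2,q)$ upper triangular. If $\mathcal F$ is an intersecting set of maximum size and $f\in\mathcal F$, then some conjugate $g f^{-1}\mathcal F g^{-1}$, $g\in\Gamma L(2,q)$, of the intersecting set $f^{-1}\mathcal F$, which contains the identity, is of one of the two types below. Moreover, the intersecting sets of maximum size that contain the identity and are contained in $\mathcal H_q$ are exactly the sets of these two types: 1. Vertical type: $V_{0,0}\cup V_{r_1,1}\cup\dots\cup V_{r_{k-1},k-1}$, where $r_0=0$, $0\le r_j\le q-2$ for $0\le j\le k-1$, and for all $0\le j<j'\le k-1$ either $\gcd(j'-j,k)=1$ or $r_j\equiv r_{j'} \pmod{2^{j'-j}-1}$. 2. Horizontal type: $H_{0,0}\cup H_{t_1,1}\cup\dots\cup H_{t_{k-1},k-1}$, where $t_0=0$, $0\le t_j\le q-2$ for $0\le j\le k-1$, and for all $0\le j<j'\le k-1$ either $\gcd(j'-j,k)=1$ or $t_j\equiv t_{j'} \pmod{2^{j'-j}-1}$. Here the indices are exponents of $\omega$, so these congruences are between elements of $\mathbb Z/(q-1)\mathbb Z$: $a\equiv b\pmod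 m$ means that $a-b\in m\mathbb Z+(q-1)\mathbb Z$. -/

import Mathlib

open scoped Matrix

namespace SemilinearEKR

/-! ### Intersecting sets and the EKR property of a finite group acting on a set -/

section EKR

variable {G : Type*} (Ω : Type*) [Group G] [MulAction G Ω]

/-- Any two elements of `S` agree on some point of `Ω`. -/
def IsIntersecting (S : Set G) : Prop :=
  ∀ g ∈ S, ∀ h ∈ S, ∃ w : Ω, g • w = h • w

/-- An intersecting set of largest possible size. -/
def IsMaximumIntersecting [Finite G] (S : Set G) : Prop :=
  IsIntersecting Ω S ∧ ∀ T : Set G, IsIntersecting Ω T → T.ncard ≤ S.ncard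

variable (G)

/-- No intersecting set is larger than a point stabilizer. -/
def HasEKR [Finite G] : Prop :=
  ∀ S : Set G, IsIntersecting Ω S →
    ∀ w : Ω, S.ncard ≤ Nat.card (MulAction.stabilizer G w)

end EKR

/-! ### The general semilinear group of degree two -/

noncomputable section

/-- The action of field automorphisms on `GL(2, F)`, entry by entry. -/
def entrywise (F : Type*) [Field F] : RingAut F →* MulAut (GL (Fin 2) F) where
  toFun σ :=
    { toFun := Matrix.GeneralLinearGroup.map (σ : F →+* F)
      invFun := Matrix.GeneralLinearGroup.map (σ.symm : F →+* F)
      left_inv := fun A => by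
        ext i j
        simp [Matrix.GeneralLinearGroup.map_apply]
      right_inv := fun A => by
        ext i j
        simp [Matrix.GeneralLinearGroup.map_apply]
      map_mul' := fun A B => map_mul _ A B }
  map_one' := by
    ext A i j
    simp [Matrix.GeneralLinearGroup.map_apply]
  map_mul' σ τ := by
    ext A i j
    simp [Matrix.GeneralLinearGroup.map_apply]

variable (p : ℕ) [Fact p.Prime] (F : Type*) [Field F] [Finite F] [CharP F p]

/-- The Frobenius automorphism `x ↦ x ^ p`. -/
abbrev frob : RingAut F := frobeniusEquiv F p

/-- The general semilinear group `GL(2, F) ⋊ ⟨frob⟩`. -/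
abbrev GammaL : Type _ :=
  GL (Fin 2) F ⋊[(entrywise F).comp (Subgroup.zpowers (frob p F)).subtype]
    Subgroup.zpowers (frob p F)

instance : Finite (RingAut F) :=
  Finite.of_injective (fun σ : RingAut F => (σ : F → F)) DFunLike.coe_injective

instance : Finite (GammaL p F) :=
  Finite.of_equiv _ SemidirectProduct.equivProd.symm

/-- The non-zero vectors of `F²`. -/
abbrev NonzeroVec (F : Type*) [Field F] : Type _ := {v : Fin 2 → F // v ≠ 0}

variable {p F}

/-- The semilinear map `v ↦ A v^σ` of `F²` given by `A σ`. -/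
def semilin (g : GammaL p F) (v : Fin 2 → F) : Fin 2 → F :=
  (g.left : Matrix (Fin 2) (Fin 2) F) *ᵥ (fun i => (g.right : RingAut F) (v i))

theorem semilin_one (v : Fin 2 → F) : semilin (1 : GammaL p F) v = v := by
  simp [semilin]

theorem semilin_mul (g h : GammaL p F) (v : Fin 2 → F) :
    semilin (g * h) v = semilin g (semilin h v) := by
  ext i
  simp [semilin, entrywise, Matrix.mulVec, dotProduct, Matrix.mul_apply, Fin.sum_univ_two]
  ring

theorem semilin_zero (g : GammaL p F) : semilin g (0 : Fin 2 → F) = 0 := by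
  ext i
  simp [semilin, Matrix.mulVec, dotProduct]

instance : MulAction (GammaL p F) (NonzeroVec F) where
  smul g v := ⟨semilin g v, fun h => v.2 <| by
    have h' := congrArg (semilin g⁻¹) h
    rwa [← semilin_mul, inv_mul_cancel, semilin_one, semilin_zero] at h'⟩
  one_smul v := Subtype.ext (semilin_one v.1)
  mul_smul g h v := Subtype.ext (semilin_mul g h v.1)

/-! ### Upper triangular elements, vertical and horizontal sets -/

/-- The matrix with rows `(x, z)` and `(0, y)`. -/
def upper (x y : Fˣ) (z : F) : GL (Fin 2) F :=
  Matrix.GeneralLinearGroup.mkOfDetNeZero !![(x : F), z; 0, (y : F)]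
    (by simp [Matrix.det_fin_two_of])

variable (p)

/-- A matrix as an element of the semilinear group. -/
def ofGL (A : GL (Fin 2) F) : GammaL p F := SemidirectProduct.inl A

variable (F)

/-- The element `φ ^ j` of the semilinear group. -/
def phiPow (j : ℕ) : GammaL p F :=
  SemidirectProduct.inr (⟨frob p F, Subgroup.mem_zpowers _⟩ ^ j)

/-- The elements `A φ ^ j` with `A` upper triangular: those that leave the line spanned by the
first basis vector invariant. -/
def upperTriangular : Set (GammaL p F) :=
  {g | ∃ (x y : Fˣ) (z : F) (j : ℕ), g = ofGL p (upper x y z) * phiPow p F j}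

variable {F}

/-- `V_{i,j}`; the scalar `ω ^ i` is the scalar matrix. -/
def V (ω : Fˣ) (i j : ℕ) : Set (GammaL p F) :=
  {g | ∃ (z : F) (y : Fˣ),
    g = ofGL p (Matrix.GeneralLinearGroup.scalar (Fin 2) (ω ^ i)) * phiPow p F j
      * ofGL p (upper 1 y z)}

/-- `H_{t,j}`. -/
def H (ω : Fˣ) (t j : ℕ) : Set (GammaL p F) :=
  {g | ∃ (x : Fˣ) (z : F), g = phiPow p F j * ofGL p (upper x (ω ^ t) z)}

end

/-- The conditions on the exponents `r 0, …, r (k - 1)` of a primitive element of the field of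
order `2 ^ k`. Such exponents live in `ℤ/(2 ^ k - 1)`, and their congruence modulo
`2 ^ (j' - j) - 1` is the congruence in that ring; for integers it is the congruence
modulo `gcd (2 ^ (j' - j) - 1) (2 ^ k - 1)`. -/
def Admissible (k : ℕ) (r : ℕ → ℕ) : Prop :=
  r 0 = 0 ∧ (∀ j < k, r j ≤ 2 ^ k - 2) ∧
    ∀ j j' : ℕ, j < j' → j' < k →
      Nat.gcd (j' - j) k = 1 ∨
        ((2 : ZMod (2 ^ k - 1)) ^ (j' - j) - 1) ∣ ((r j' : ZMod (2 ^ k - 1)) - r j)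

section

variable {F : Type*} [Field F] [Finite F] [CharP F 2]

/-- `S = V_{0,0} ∪ V_{r 1,1} ∪ … ∪ V_{r (k-1),k-1}` with admissible exponents. -/
def IsVerticalType (k : ℕ) (ω : Fˣ) (S : Set (GammaL 2 F)) : Prop :=
  ∃ r : ℕ → ℕ, Admissible k r ∧ S = ⋃ j ∈ Finset.range k, V 2 ω (r j) j

/-- `S = H_{0,0} ∪ H_{t 1,1} ∪ … ∪ H_{t (k-1),k-1}` with admissible exponents. -/
def IsHorizontalType (k : ℕ) (ω : Fˣ) (S : Set (GammaL 2 F)) : Prop :=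
  ∃ t : ℕ → ℕ, Admissible k t ∧ S = ⋃ j ∈ Finset.range k, H 2 ω (t j) j

end

end SemilinearEKR

/-! Sort an intersecting set `S` by field automorphism: the slice over σ consists of the matrices A
with Aσ in `S`. Two matrices of one slice agree on a non-zero vector, so their difference is
singular. A family of 2×2 matrices with pairwise singular differences has, after translation by a
member, a common right or left kernel vector (`common_kernel_of_det_sub_eq_zero`). Hence each slice
lies in some `Vert v u` or `Hor l m`, both of size q(q-1). There are k slices, which gives the bound
kq(q-1); a point stabilizer attains it, and in a maximum set every slice is a full `Vert` or `Hor`.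

Slices over σ and ρσ are compared through a scalar. If ρ fixes some x other than 0 and 1, then x ↦
x/ρ(x) misses a unit c, so w and cρ(w) are equal for no non-zero w; nor do the twists X P⁻¹ and X c
ρ(P)⁻¹ agree (`not_agree_of_mulVec`). X and P can be chosen to put this pair into the two slices
unless both are vertical in matching directions or both horizontal with matching functionals
(`parallel_of_agree_Vert_Vert`, `parallel_of_agree_Hor_Hor`, `not_agree_Vert_Hor`). Since k is not a
prime power, either k = 1 or two distinct primes p, r divide k; powers of φ^p and φ^r have such
fixed points, and by Bézout every σ is a product of two of them (`exists_mul_hasObstruction`). Two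
steps from the identity slice therefore reach every slice: a maximum set containing the identity is
vertical for one vector or horizontal for one functional. It preserves a line, which a conjugation
moves to the first axis.

Only the multipliers of the slices remain, as powers of ω. The set is intersecting exactly when ω^a
x = ω^b x^(2^d) is solvable for each pair of slices, a divisibility by 2^d - 1 in ℤ/(q-1)
(`exists_pow_mul_eq_iff`). Scalar matrices in the slices give necessity; `agree_of_mem_Vert_basis`
and `agree_of_mem_Hor_basis` give sufficiency. -/

namespace SemilinearEKR

/-! ### Vectors and matrices of size two -/

section Plane

variable {F : Type*} [Field F]

/-- The determinant of the matrix with columns `u` and `v`. -/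
def det₂ (u v : Fin 2 → F) : F := u 0 * v 1 - u 1 * v 0

theorem exists_smul_of_det₂_eq_zero {u v : Fin 2 → F} (hu : u ≠ 0) (h : det₂ u v = 0) :
    ∃ a : F, v = a • u := by
  unfold det₂ at h
  by_cases h0 : u 0 = 0
  · have h1 : u 1 ≠ 0 := fun h1 => hu (by ext i; fin_cases i <;> simp [h0, h1])
    refine ⟨v 1 / u 1, ?_⟩
    ext i; fin_cases i
    · simp [h0] at h ⊢; tauto
    · simp [h1]
  · refine ⟨v 0 / u 0, ?_⟩
    ext i; fin_cases i
    · simp [h0]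
    · simp; field_simp; linear_combination h

theorem smul_ne_zero_of_eq {a : F} {u v : Fin 2 → F} (hv : v ≠ 0) (h : v = a • u) : a ≠ 0 := by
  rintro rfl
  exact hv (by simpa using h)

theorem GL_inv_mul (A : GL (Fin 2) F) :
    ((A⁻¹ : GL (Fin 2) F) : Matrix (Fin 2) (Fin 2) F) * (A : Matrix (Fin 2) (Fin 2) F) = 1 := by
  rw [← Units.val_mul, inv_mul_cancel, Units.val_one]

theorem GL_mul_inv (A : GL (Fin 2) F) :
    (A : Matrix (Fin 2) (Fin 2) F) * ((A⁻¹ : GL (Fin 2) F) : Matrix (Fin 2) (Fin 2) F) = 1 := by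
  rw [← Units.val_mul, mul_inv_cancel, Units.val_one]

theorem mulVec_inv_eq {A : GL (Fin 2) F} {u v : Fin 2 → F}
    (h : (A : Matrix (Fin 2) (Fin 2) F) *ᵥ u = v) :
    ((A⁻¹ : GL (Fin 2) F) : Matrix (Fin 2) (Fin 2) F) *ᵥ v = u := by
  rw [← h, Matrix.mulVec_mulVec, GL_inv_mul, Matrix.one_mulVec]

theorem mulVec_GL_ne_zero (A : GL (Fin 2) F) {v : Fin 2 → F} (hv : v ≠ 0) :
    (A : Matrix (Fin 2) (Fin 2) F) *ᵥ v ≠ 0 := fun h => hv (by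
  rw [← mulVec_inv_eq h, Matrix.mulVec_zero])

/-- The invertible matrix with columns `a` and `b`. -/
noncomputable def ofCols (a b : Fin 2 → F) (h : det₂ a b ≠ 0) : GL (Fin 2) F :=
  Matrix.GeneralLinearGroup.mkOfDetNeZero !![a 0, b 0; a 1, b 1]
    (by rw [Matrix.det_fin_two_of]; unfold det₂ at h; rwa [mul_comm (b 0)])

theorem ofCols_mulVec (a b : Fin 2 → F) (h : det₂ a b ≠ 0) (v : Fin 2 → F) :
    (ofCols a b h : Matrix (Fin 2) (Fin 2) F) *ᵥ v = v 0 • a + v 1 • b := by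
  ext i
  fin_cases i <;>
    simp [ofCols, Matrix.GeneralLinearGroup.mkOfDetNeZero, Matrix.mulVec, dotProduct,
      Fin.sum_univ_two] <;> ring

theorem exists_GL_mulVec_pair {a b a' b' : Fin 2 → F} (h : det₂ a b ≠ 0) (h' : det₂ a' b' ≠ 0) :
    ∃ M : GL (Fin 2) F, (M : Matrix (Fin 2) (Fin 2) F) *ᵥ a = a' ∧
      (M : Matrix (Fin 2) (Fin 2) F) *ᵥ b = b' := by
  have key : ∀ {c d : Fin 2 → F} (h : det₂ c d ≠ 0),
      (ofCols c d h : Matrix (Fin 2) (Fin 2) F) *ᵥ ![1, 0] = c ∧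
      (ofCols c d h : Matrix (Fin 2) (Fin 2) F) *ᵥ ![0, 1] = d := by
    intro c d h
    constructor <;> rw [ofCols_mulVec] <;> simp
  refine ⟨ofCols a' b' h' * (ofCols a b h)⁻¹, ?_, ?_⟩
  · rw [Units.val_mul, ← Matrix.mulVec_mulVec, mulVec_inv_eq (key h).1, (key h').1]
  · rw [Units.val_mul, ← Matrix.mulVec_mulVec, mulVec_inv_eq (key h).2, (key h').2]

theorem exists_det₂_ne_zero {a : Fin 2 → F} (ha : a ≠ 0) : ∃ b, det₂ a b ≠ 0 := by
  by_contra! h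
  refine ha ?_
  have h0 := h ![0, 1]
  have h1 := h ![1, 0]
  ext i; fin_cases i
  · simpa [det₂] using h0
  · simpa [det₂] using h1

theorem exists_GL_mulVec {a a' : Fin 2 → F} (ha : a ≠ 0) (ha' : a' ≠ 0) :
    ∃ M : GL (Fin 2) F, (M : Matrix (Fin 2) (Fin 2) F) *ᵥ a = a' := by
  obtain ⟨b, hb⟩ := exists_det₂_ne_zero ha
  obtain ⟨b', hb'⟩ := exists_det₂_ne_zero ha'
  obtain ⟨M, hM, -⟩ := exists_GL_mulVec_pair hb hb'
  exact ⟨M, hM⟩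

/-- The transpose of an invertible matrix. -/
noncomputable def transposeGL (A : GL (Fin 2) F) : GL (Fin 2) F :=
  Matrix.GeneralLinearGroup.mkOfDetNeZero (A : Matrix (Fin 2) (Fin 2) F)ᵀ
    (by rw [Matrix.det_transpose]; exact (Matrix.GeneralLinearGroup.det A).ne_zero)

@[simp]
theorem coe_transposeGL (A : GL (Fin 2) F) :
    (transposeGL A : Matrix (Fin 2) (Fin 2) F) = (A : Matrix (Fin 2) (Fin 2) F)ᵀ := rfl

theorem transposeGL_transposeGL (A : GL (Fin 2) F) : transposeGL (transposeGL A) = A := by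
  ext; simp

/-- A covector and a vector, both non-zero, are determined up to a change of basis by their
pairing. -/
theorem exists_GL_mulVec_vecMul {x y v n : Fin 2 → F} (hx : x ≠ 0) (hy : y ≠ 0) (hv : v ≠ 0)
    (hn : n ≠ 0) (h : y ⬝ᵥ x = n ⬝ᵥ v) :
    ∃ P : GL (Fin 2) F, (P : Matrix (Fin 2) (Fin 2) F) *ᵥ x = v ∧
      n ᵥ* (P : Matrix (Fin 2) (Fin 2) F) = y := by
  have key : ∀ {x y : Fin 2 → F}, x ≠ 0 → y ≠ 0 → ∃ z, y ⬝ᵥ z = 1 ∧ det₂ x z ≠ 0 := by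
    intro x y hx hy
    obtain ⟨z, hz⟩ : ∃ z, y ⬝ᵥ z = 1 := by
      by_cases h0 : y 0 = 0
      · have h1 : y 1 ≠ 0 := fun h1 => hy (by ext i; fin_cases i <;> simp [h0, h1])
        exact ⟨![0, (y 1)⁻¹], by simp [dotProduct, h1]⟩
      · exact ⟨![(y 0)⁻¹, 0], by simp [dotProduct, h0]⟩
    by_cases hd : det₂ x z = 0
    · obtain ⟨a, ha⟩ := exists_smul_of_det₂_eq_zero hx hd
      -- The added vector is killed by y and changes `det₂ x z` by y ⬝ x, which is non-zero because
      -- z is a multiple of x with y ⬝ z = 1.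
      refine ⟨z + ![- y 1, y 0], ?_, ?_⟩
      · rw [dotProduct_add, hz]; simp [dotProduct, Fin.sum_univ_two]; ring
      · intro h'
        have e : det₂ x (z + ![- y 1, y 0]) = det₂ x z + y ⬝ᵥ x := by
          simp [det₂, dotProduct, Fin.sum_univ_two]; ring
        rw [e, hd, zero_add] at h'
        rw [ha, dotProduct_smul, h'] at hz
        simp at hz
    · exact ⟨z, hz, hd⟩
  obtain ⟨z, hz, hxz⟩ := key hx hy
  obtain ⟨z', hz', hvz⟩ := key hv hn
  obtain ⟨P, hP, hP'⟩ := exists_GL_mulVec_pair hxz hvz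
  refine ⟨P, hP, ?_⟩
  have e1 : (n ᵥ* (P : Matrix (Fin 2) (Fin 2) F)) ⬝ᵥ x = y ⬝ᵥ x := by
    rw [← Matrix.dotProduct_mulVec, hP, h]
  have e2 : (n ᵥ* (P : Matrix (Fin 2) (Fin 2) F)) ⬝ᵥ z = y ⬝ᵥ z := by
    rw [← Matrix.dotProduct_mulVec, hP', hz', hz]
  generalize n ᵥ* (P : Matrix (Fin 2) (Fin 2) F) = t at e1 e2
  simp only [dotProduct, Fin.sum_univ_two] at e1 e2
  unfold det₂ at hxz
  ext i; fin_cases i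
  · apply mul_right_cancel₀ hxz
    change t 0 * _ = y 0 * _; linear_combination z 1 * e1 - x 1 * e2
  · apply mul_right_cancel₀ hxz
    change t 1 * _ = y 1 * _; linear_combination x 0 * e2 - z 0 * e1

/-! ### Sets of matrices whose differences are singular -/

theorem exists_eq_vecMulVec_of_det_eq_zero {N : Matrix (Fin 2) (Fin 2) F} (h : N.det = 0) :
    ∃ x y : Fin 2 → F, N = Matrix.vecMulVec x y := by
  rw [Matrix.det_fin_two] at h
  by_cases h0 : N 0 = 0
  · refine ⟨![0, 1], N 1, ?_⟩
    ext i j; fin_cases i <;> simp [Matrix.vecMulVec_apply, h0]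
  · obtain ⟨a, ha⟩ := exists_smul_of_det₂_eq_zero (v := N 1) h0
      (by unfold det₂; linear_combination h)
    refine ⟨![1, a], N 0, ?_⟩
    ext i j; fin_cases i <;> simp [Matrix.vecMulVec_apply, ha]

/-- A difference of two rank-one matrices is singular only if their column factors or their row
factors are parallel. -/
theorem det_vecMulVec_sub_vecMulVec (x y x' y' : Fin 2 → F) :
    (Matrix.vecMulVec x y - Matrix.vecMulVec x' y').det = - (det₂ x x' * det₂ y y') := by
  simp [Matrix.det_fin_two, Matrix.vecMulVec_apply, det₂]; ring

/-- Matrices with pairwise singular differences, one of which is zero, have a common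
kernel vector or a common left kernel vector. -/
theorem common_kernel_of_det_sub_eq_zero {𝒩 : Set (Matrix (Fin 2) (Fin 2) F)} (h0 : 0 ∈ 𝒩)
    (h : ∀ M ∈ 𝒩, ∀ N ∈ 𝒩, (M - N).det = 0) :
    (∃ v ≠ 0, ∀ N ∈ 𝒩, N *ᵥ v = 0) ∨ (∃ l ≠ 0, ∀ N ∈ 𝒩, l ᵥ* N = 0) := by
  have perp : ∀ {y : Fin 2 → F}, y ≠ 0 → (![- y 1, y 0] : Fin 2 → F) ≠ 0 := by
    intro y hy h
    apply hy
    have := congrFun h 0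
    have := congrFun h 1
    ext i; fin_cases i <;> simp_all
  have kerR : ∀ x y z : Fin 2 → F, det₂ y z = 0 →
      Matrix.vecMulVec x z *ᵥ ![- y 1, y 0] = 0 := by
    intro x y z h
    unfold det₂ at h
    ext i
    simp [Matrix.vecMulVec_apply, Matrix.mulVec, dotProduct, Fin.sum_univ_two]
    linear_combination x i * h
  have kerL : ∀ x y z : Fin 2 → F, det₂ x z = 0 →
      ![- x 1, x 0] ᵥ* Matrix.vecMulVec z y = 0 := by
    intro x y z h
    unfold det₂ at h
    ext i
    simp [Matrix.vecMulVec_apply, Matrix.vecMul, dotProduct, Fin.sum_univ_two]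
    linear_combination y i * h
  have rk : ∀ N ∈ 𝒩, ∃ x y : Fin 2 → F, N = Matrix.vecMulVec x y := fun N hN =>
    exists_eq_vecMulVec_of_det_eq_zero (by simpa using h N hN 0 h0)
  by_cases hall : ∃ N ∈ 𝒩, N ≠ 0
  swap
  · push Not at hall
    refine Or.inl ⟨![1, 0], by simp, fun N hN => by simp [hall N hN]⟩
  obtain ⟨N₁, hN₁, hne₁⟩ := hall
  obtain ⟨x₁, y₁, rfl⟩ := rk N₁ hN₁
  have hx₁ : x₁ ≠ 0 := by rintro rfl; simp at hne₁
  have hy₁ : y₁ ≠ 0 := by rintro rfl; simp at hne₁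
  -- If the kernel of y₁ is not common to all, some N₂ has y₂ independent of y₁, which forces x₂
  -- parallel to x₁. A matrix whose column factor is not parallel to x₁ would then need a row factor
  -- parallel to both y₁ and y₂, so it is zero.
  by_cases hy : ∀ N ∈ 𝒩, N *ᵥ ![- y₁ 1, y₁ 0] = 0
  · exact Or.inl ⟨_, perp hy₁, hy⟩
  push Not at hy
  obtain ⟨N₂, hN₂, hne₂⟩ := hy
  obtain ⟨x₂, y₂, rfl⟩ := rk N₂ hN₂
  have hx₂ : x₂ ≠ 0 := by rintro rfl; simp at hne₂
  have hy₁₂ : det₂ y₁ y₂ ≠ 0 := fun h => hne₂ (kerR _ _ _ h)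
  have hx₁₂ : det₂ x₁ x₂ = 0 := by
    have := h _ hN₁ _ hN₂
    rw [det_vecMulVec_sub_vecMulVec, neg_eq_zero, mul_eq_zero] at this
    exact this.resolve_right hy₁₂
  refine Or.inr ⟨_, perp hx₁, fun N hN => ?_⟩
  obtain ⟨x, y, rfl⟩ := rk N hN
  by_cases hx : det₂ x₁ x = 0
  · exact kerL _ _ _ hx
  have e1 : det₂ y₁ y = 0 := by
    have := h _ hN₁ _ hN
    rw [det_vecMulVec_sub_vecMulVec, neg_eq_zero, mul_eq_zero] at this
    exact this.resolve_left hx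
  have e2 : det₂ y₂ y = 0 := by
    have := h _ hN₂ _ hN
    rw [det_vecMulVec_sub_vecMulVec, neg_eq_zero, mul_eq_zero] at this
    refine this.resolve_left fun hx' => hx ?_
    obtain ⟨a, rfl⟩ := exists_smul_of_det₂_eq_zero hx₂ hx'
    simp only [det₂, Pi.smul_apply, smul_eq_mul] at hx₁₂ ⊢
    linear_combination a * hx₁₂
  have hy0 : y = 0 := by
    obtain ⟨a, rfl⟩ := exists_smul_of_det₂_eq_zero hy₁ e1
    have : a * det₂ y₁ y₂ = 0 := by
      simp only [det₂, Pi.smul_apply, smul_eq_mul] at e2 ⊢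
      linear_combination -e2
    rcases mul_eq_zero.1 this with h | h
    · simp [h]
    · exact absurd h hy₁₂
  simp [hy0]

end Plane

/-! ### Pairs of slices over two field automorphisms -/

section Slices

variable {F : Type*} [Field F]

/-- The invertible matrices that map `v` to `u`. -/
def Vert (v u : Fin 2 → F) : Set (GL (Fin 2) F) :=
  {A | (A : Matrix (Fin 2) (Fin 2) F) *ᵥ v = u}

/-- The invertible matrices that map the row `l` to the row `m`. -/
def Hor (l m : Fin 2 → F) : Set (GL (Fin 2) F) :=
  {A | l ᵥ* (A : Matrix (Fin 2) (Fin 2) F) = m}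

theorem Hor_eq_preimage_Vert (l m : Fin 2 → F) : Hor l m = transposeGL ⁻¹' Vert l m := by
  ext A
  change _ = _ ↔ _ = _
  rw [coe_transposeGL, Matrix.mulVec_transpose]

theorem Vert_smul {a b : F} (ha : a ≠ 0) (v u : Fin 2 → F) :
    Vert (a • v) (b • u) = Vert v ((b / a) • u) := by
  ext A
  simp only [Vert, Set.mem_ofPred_eq, Matrix.mulVec_smul]
  constructor <;> intro h
  · rw [div_eq_inv_mul, mul_smul, ← h, inv_smul_smul₀ ha]
  · rw [h, smul_smul, mul_div_cancel₀ _ ha]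

theorem Hor_smul {a b : F} (ha : a ≠ 0) (v u : Fin 2 → F) :
    Hor (a • v) (b • u) = Hor v ((b / a) • u) := by
  rw [Hor_eq_preimage_Vert, Vert_smul ha, ← Hor_eq_preimage_Vert]

theorem ne_zero_of_mem_Vert {v u : Fin 2 → F} (hv : v ≠ 0) {A : GL (Fin 2) F}
    (hA : A ∈ Vert v u) : u ≠ 0 := by
  rw [← show _ = u from hA]
  exact mulVec_GL_ne_zero A hv

theorem ne_zero_of_mem_Hor {l m : Fin 2 → F} (hl : l ≠ 0) {A : GL (Fin 2) F}
    (hA : A ∈ Hor l m) : m ≠ 0 := by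
  rw [Hor_eq_preimage_Vert] at hA
  exact ne_zero_of_mem_Vert hl hA

/-- The map `w ↦ A w` agrees with the semilinear map `w ↦ B w^ρ` on a non-zero vector. -/
def Agree (ρ : RingAut F) (A B : GL (Fin 2) F) : Prop :=
  ∃ w : Fin 2 → F, w ≠ 0 ∧
    (A : Matrix (Fin 2) (Fin 2) F) *ᵥ w = (B : Matrix (Fin 2) (Fin 2) F) *ᵥ (ρ ∘ w)

theorem ringAut_comp_ne_zero (ρ : RingAut F) {v : Fin 2 → F} (hv : v ≠ 0) : ρ ∘ v ≠ 0 :=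
  fun h => hv (by ext i; simpa using congrFun h i)

theorem ringAut_comp_smul (ρ : RingAut F) (a : F) (v : Fin 2 → F) :
    ρ ∘ (a • v) = ρ a • (ρ ∘ v) := by
  ext i; simp

theorem ringAut_comp_symm_comp (ρ : RingAut F) (v : Fin 2 → F) : ρ ∘ (ρ.symm ∘ v) = v := by
  ext i; exact ρ.apply_symm_apply _

theorem ringAut_comp_mulVec (ρ : RingAut F) (M : Matrix (Fin 2) (Fin 2) F) (v : Fin 2 → F) :
    ρ ∘ (M *ᵥ v) = M.map ρ *ᵥ (ρ ∘ v) := by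
  ext i; fin_cases i <;> simp [Matrix.mulVec, dotProduct, Fin.sum_univ_two]

theorem ringAut_comp_vecMul (ρ : RingAut F) (M : Matrix (Fin 2) (Fin 2) F) (v : Fin 2 → F) :
    ρ ∘ (v ᵥ* M) = (ρ ∘ v) ᵥ* M.map ρ := by
  ext i; simp [Matrix.vecMul, dotProduct, Fin.sum_univ_two]

theorem coe_entrywise (ρ : RingAut F) (A : GL (Fin 2) F) :
    (entrywise F ρ A : Matrix (Fin 2) (Fin 2) F) = (A : Matrix (Fin 2) (Fin 2) F).map ρ := rfl

/-! ### Automorphisms with a scalar obstruction -/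

/-- The automorphism `ρ` admits scalars outside the image of `x ↦ x / ρ x`. -/
def HasObstruction (ρ : RingAut F) : Prop :=
  ∃ c : Fˣ, ∀ x : F, x = c * ρ x → x = 0

/-- The map y ↦ y/ρ(y) on the finite set of units takes the value 1 at both x and 1. Not being
injective it is not surjective, and any missed unit is the required scalar. -/
theorem hasObstruction_of_fixed [Finite F] {ρ : RingAut F} {x : F} (h0 : x ≠ 0) (h1 : x ≠ 1)
    (hx : ρ x = x) : HasObstruction ρ := by
  by_contra h
  unfold HasObstruction at h
  push Not at h
  let f : Fˣ → Fˣ := fun y => y / Units.map (ρ : F →* F) y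
  have hs : Function.Surjective f := by
    intro c
    obtain ⟨y, hy, hy0⟩ := h c
    refine ⟨Units.mk0 y hy0, ?_⟩
    simp only [f]
    rw [div_eq_iff_eq_mul]
    ext
    simpa using hy
  have hi := Finite.injective_iff_surjective.2 hs
  apply h1
  have : f (Units.mk0 x h0) = f 1 := by
    simp only [f]
    rw [div_eq_iff_eq_mul]
    ext
    simp [hx]
  simpa using congrArg Units.val (hi this)

theorem scalar_mulVec (c : Fˣ) (v : Fin 2 → F) :
    (Matrix.GeneralLinearGroup.scalar (Fin 2) c : Matrix (Fin 2) (Fin 2) F) *ᵥ v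
      = (c : F) • v := by
  ext i; fin_cases i <;>
    simp [Matrix.GeneralLinearGroup.scalar, Matrix.mulVec, dotProduct, Fin.sum_univ_two]

theorem vecMul_scalar (c : Fˣ) (v : Fin 2 → F) :
    v ᵥ* (Matrix.GeneralLinearGroup.scalar (Fin 2) c : Matrix (Fin 2) (Fin 2) F)
      = (c : F) • v := by
  ext i; fin_cases i <;>
    simp [Matrix.GeneralLinearGroup.scalar, Matrix.vecMul, dotProduct, Fin.sum_univ_two, mul_comm]

/-- Twists of a scalar obstruction by a change of basis never agree. -/
theorem not_agree_of_mulVec {ρ : RingAut F} {c : Fˣ} (hc : ∀ x : F, x = c * ρ x → x = 0)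
    (X P : GL (Fin 2) F) :
    ¬ Agree ρ (X * P⁻¹)
      (X * Matrix.GeneralLinearGroup.scalar (Fin 2) c * (entrywise F ρ P)⁻¹) := by
  rintro ⟨w, hw, h⟩
  -- In the coordinates x = P⁻¹w, after cancelling X, the equation reads x = cρ(x) entry by entry.
  set x : Fin 2 → F := ((P⁻¹ : GL (Fin 2) F) : Matrix (Fin 2) (Fin 2) F) *ᵥ w with hx
  have h1 : ((entrywise F ρ P)⁻¹ : GL (Fin 2) F).val *ᵥ (ρ ∘ w) = ρ ∘ x := by
    rw [← map_inv, coe_entrywise, hx, ringAut_comp_mulVec]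
  rw [Units.val_mul, Units.val_mul, Units.val_mul, ← Matrix.mulVec_mulVec,
    ← Matrix.mulVec_mulVec, h1, ← Matrix.mulVec_mulVec] at h
  have h2 := congrArg (fun v => ((X⁻¹ : GL (Fin 2) F) : Matrix (Fin 2) (Fin 2) F) *ᵥ v) h
  simp only [mulVec_inv_eq rfl] at h2
  refine mulVec_GL_ne_zero P⁻¹ hw ?_
  rw [← hx] at h2 ⊢
  ext i
  apply hc
  rw [scalar_mulVec] at h2
  exact congrFun h2 i

/-! ### Compatibility of two slices over different automorphisms -/

theorem exists_apply_ne_of_ne_one {ρ : RingAut F} (hρ : ρ ≠ 1) : ∃ a : F, ρ a ≠ a := by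
  by_contra! h
  exact hρ (RingEquiv.ext h)

/-- M and N exist as soon as x, y are dependent in the same way as v, t, and x, ρ(y) in the same way
as u, s. An a with ρ(a) ≠ a makes the vector (1, a) independent of its image under ρ, so either one
of the two pairs can be made dependent while the other stays independent. -/
theorem exists_GL_twisted_pair {ρ : RingAut F} (hρ : ρ ≠ 1) {v t u s : Fin 2 → F} (hv : v ≠ 0)
    (ht : t ≠ 0) (hu : u ≠ 0) (hs : s ≠ 0) (h : ¬ (det₂ v t = 0 ∧ det₂ u s = 0)) :
    ∃ (x y : Fin 2 → F) (M N : GL (Fin 2) F),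
      (M : Matrix (Fin 2) (Fin 2) F) *ᵥ x = v ∧ (M : Matrix (Fin 2) (Fin 2) F) *ᵥ y = t ∧
      (N : Matrix (Fin 2) (Fin 2) F) *ᵥ x = u ∧
      (N : Matrix (Fin 2) (Fin 2) F) *ᵥ (ρ ∘ y) = s := by
  obtain ⟨a, ha⟩ := exists_apply_ne_of_ne_one hρ
  have hne : ∀ b : F, (![1, b] : Fin 2 → F) ≠ 0 := fun b h => by
    simpa using congrFun h 0
  by_cases hvt : det₂ v t = 0
  · have hus : det₂ u s ≠ 0 := fun h' => h ⟨hvt, h'⟩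
    obtain ⟨b, rfl⟩ := exists_smul_of_det₂_eq_zero hv hvt
    have hb : b ≠ 0 := smul_ne_zero_of_eq ht rfl
    have hd : det₂ ![1, a] (ρ ∘ (b • ![1, a])) ≠ 0 := by
      have : det₂ ![1, a] (ρ ∘ (b • ![1, a])) = ρ b * (ρ a - a) := by
        simp [det₂]; ring
      rw [this]
      exact mul_ne_zero (by simpa using hb) (sub_ne_zero.2 ha)
    obtain ⟨M, hM⟩ := exists_GL_mulVec (hne a) hv
    obtain ⟨N, hN, hN'⟩ := exists_GL_mulVec_pair hd hus
    exact ⟨_, _, M, N, hM, by rw [Matrix.mulVec_smul, hM], hN, hN'⟩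
  by_cases hus : det₂ u s = 0
  · obtain ⟨b, rfl⟩ := exists_smul_of_det₂_eq_zero hu hus
    have hb : b ≠ 0 := smul_ne_zero_of_eq hs rfl
    have hd : det₂ (b⁻¹ • (ρ ∘ ![1, a])) ![1, a] ≠ 0 := by
      have : det₂ (b⁻¹ • (ρ ∘ ![1, a])) ![1, a] = - (b⁻¹ * (ρ a - a)) := by
        simp [det₂]; ring
      rw [this]
      exact neg_ne_zero.2 (mul_ne_zero (inv_ne_zero hb) (sub_ne_zero.2 ha))
    obtain ⟨M, hM, hM'⟩ := exists_GL_mulVec_pair hd hvt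
    obtain ⟨N, hN⟩ := exists_GL_mulVec
      (smul_ne_zero (inv_ne_zero hb) (ringAut_comp_ne_zero ρ (hne a))) hu
    refine ⟨_, _, M, N, hM, hM', hN, ?_⟩
    rw [← hN, ← Matrix.mulVec_smul, smul_inv_smul₀ hb]
  -- Both pairs are independent: the standard basis serves, since ρ fixes it.
  · have h1 : det₂ ![1, 0] (![0, 1] : Fin 2 → F) ≠ 0 := by simp [det₂]
    have h2 : ρ ∘ (![0, 1] : Fin 2 → F) = ![0, 1] := by ext i; fin_cases i <;> simp
    obtain ⟨M, hM, hM'⟩ := exists_GL_mulVec_pair h1 hvt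
    obtain ⟨N, hN, hN'⟩ := exists_GL_mulVec_pair h1 hus
    exact ⟨_, _, M, N, hM, hM', hN, by rw [h2, hN']⟩

/-- Otherwise `exists_GL_twisted_pair` yields P and X for which X P⁻¹ lies in the first slice and X
c ρ(P)⁻¹ in the second, and these never agree. The factor c is absorbed by asking for c⁻¹ u' in
place of u'. -/
theorem parallel_of_agree_Vert_Vert {ρ : RingAut F} (hρ : ρ ≠ 1) (hobs : HasObstruction ρ)
    {v u v' u' : Fin 2 → F} (hv : v ≠ 0) (hu : u ≠ 0) (hv' : v' ≠ 0) (hu' : u' ≠ 0)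
    (hag : ∀ A ∈ Vert v u, ∀ B ∈ Vert v' u', Agree ρ A B) :
    det₂ v (ρ.symm ∘ v') = 0 ∧ det₂ u u' = 0 := by
  obtain ⟨c, hc⟩ := hobs
  by_contra h
  have hsc : det₂ u ((c⁻¹ : F) • u') = (c⁻¹ : F) * det₂ u u' := by simp [det₂]; ring
  obtain ⟨x, y, P, X, h1, h2, h3, h4⟩ := exists_GL_twisted_pair hρ hv
    (ringAut_comp_ne_zero ρ.symm hv') hu (smul_ne_zero (inv_ne_zero c.ne_zero) hu')
    (fun h' => h ⟨h'.1, by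
      have := h'.2
      rw [hsc] at this
      exact (mul_eq_zero.1 this).resolve_left (inv_ne_zero c.ne_zero)⟩)
  refine not_agree_of_mulVec hc X P (hag _ ?_ _ ?_)
  · change _ = _
    rw [Units.val_mul, ← Matrix.mulVec_mulVec, mulVec_inv_eq h1, h3]
  · change _ = _
    have h5 : (entrywise F ρ P : Matrix (Fin 2) (Fin 2) F) *ᵥ (ρ ∘ y) = v' := by
      rw [coe_entrywise, ← ringAut_comp_mulVec, h2, ringAut_comp_symm_comp]
    rw [Units.val_mul, Units.val_mul, ← Matrix.mulVec_mulVec, ← Matrix.mulVec_mulVec,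
      mulVec_inv_eq h5, scalar_mulVec, Matrix.mulVec_smul, h4, smul_inv_smul₀ c.ne_zero]

theorem vecMul_inv_eq {A : GL (Fin 2) F} {u v : Fin 2 → F}
    (h : u ᵥ* (A : Matrix (Fin 2) (Fin 2) F) = v) :
    v ᵥ* ((A⁻¹ : GL (Fin 2) F) : Matrix (Fin 2) (Fin 2) F) = u := by
  rw [← h, Matrix.vecMul_vecMul, GL_mul_inv, Matrix.vecMul_one]

/-- The vertical argument for row vectors, so the matrices M, N of `exists_GL_twisted_pair` enter
through their inverse transposes. -/
theorem parallel_of_agree_Hor_Hor {ρ : RingAut F} (hρ : ρ ≠ 1) (hobs : HasObstruction ρ)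
    {l m l' m' : Fin 2 → F} (hl : l ≠ 0) (hm : m ≠ 0) (hl' : l' ≠ 0) (hm' : m' ≠ 0)
    (hag : ∀ A ∈ Hor l m, ∀ B ∈ Hor l' m', Agree ρ A B) :
    det₂ m (ρ.symm ∘ m') = 0 ∧ det₂ l l' = 0 := by
  obtain ⟨c, hc⟩ := hobs
  by_contra h
  have hsc : det₂ l ((c : F) • l') = (c : F) * det₂ l l' := by simp [det₂]; ring
  obtain ⟨x, y, M, N, h1, h2, h3, h4⟩ := exists_GL_twisted_pair hρ hm
    (ringAut_comp_ne_zero ρ.symm hm') hl (smul_ne_zero c.ne_zero hl')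
    (fun h' => h ⟨h'.1, by
      have := h'.2
      rw [hsc] at this
      exact (mul_eq_zero.1 this).resolve_left c.ne_zero⟩)
  have tr : ∀ {A : GL (Fin 2) F} {a b : Fin 2 → F},
      (A : Matrix (Fin 2) (Fin 2) F) *ᵥ a = b →
      a ᵥ* (transposeGL A : Matrix (Fin 2) (Fin 2) F) = b := by
    intro A a b h
    rw [coe_transposeGL, Matrix.vecMul_transpose, h]
  refine not_agree_of_mulVec hc (transposeGL N)⁻¹ (transposeGL M)⁻¹ (hag _ ?_ _ ?_)
  · change _ = _
    rw [inv_inv, Units.val_mul, ← Matrix.vecMul_vecMul, vecMul_inv_eq (tr h3), tr h1]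
  · change _ = _
    rw [map_inv, inv_inv, Units.val_mul, Units.val_mul, ← Matrix.vecMul_vecMul,
      ← Matrix.vecMul_vecMul, vecMul_scalar, ← Matrix.smul_vecMul, vecMul_inv_eq (tr h4),
      coe_entrywise, coe_transposeGL, Matrix.transpose_map, Matrix.vecMul_transpose,
      ← ringAut_comp_mulVec, h2, ringAut_comp_symm_comp]

/-- To place the twisted pair in the two slices, P must carry x to v and n = ρ⁻¹(m) to y, and X must
carry x to u and l to c⁻¹ρ(y). By `exists_GL_mulVec_vecMul` only the pairings y ⬝ x and ρ(y) ⬝ x are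
constrained. With y = (1, a) and ρ(a) ≠ a this is an invertible linear system for x. -/
theorem not_agree_Vert_Hor {ρ : RingAut F} (hρ : ρ ≠ 1) (hobs : HasObstruction ρ)
    {v u l m : Fin 2 → F} (hv : v ≠ 0) (hu : u ≠ 0) (hl : l ≠ 0) (hm : m ≠ 0) :
    ¬ ∀ A ∈ Vert v u, ∀ B ∈ Hor l m, Agree ρ A B := by
  obtain ⟨c, hc⟩ := hobs
  obtain ⟨a, ha⟩ := exists_apply_ne_of_ne_one hρ
  intro hag
  set n := ρ.symm ∘ m with hn
  have hn0 : n ≠ 0 := ringAut_comp_ne_zero ρ.symm hm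
  obtain ⟨x, y, hx, hy, h1, h2⟩ : ∃ x y : Fin 2 → F, x ≠ 0 ∧ y ≠ 0 ∧ y ⬝ᵥ x = n ⬝ᵥ v ∧
      (ρ ∘ y) ⬝ᵥ x = c * (l ⬝ᵥ u) := by
    -- When both prescribed pairings vanish the linear system would give x = 0, so the two basis
    -- vectors are used instead.
    by_cases h0 : n ⬝ᵥ v = 0 ∧ c * (l ⬝ᵥ u) = 0
    · exact ⟨![1, 0], ![0, 1], by simp, by simp, by rw [h0.1]; simp [dotProduct],
        by rw [h0.2]; simp [dotProduct]⟩
    · generalize n ⬝ᵥ v = b at *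
      generalize c * (l ⬝ᵥ u) = d at *
      have hd : ρ a - a ≠ 0 := sub_ne_zero.2 ha
      have e1 : ![1, a] ⬝ᵥ ![b - a * ((d - b) / (ρ a - a)), (d - b) / (ρ a - a)] = b := by
        simp [dotProduct, Fin.sum_univ_two]
      have e2 : (ρ ∘ ![1, a]) ⬝ᵥ ![b - a * ((d - b) / (ρ a - a)), (d - b) / (ρ a - a)] = d := by
        simp [dotProduct, Fin.sum_univ_two]; field_simp; ring
      refine ⟨_, ![1, a], ?_, ?_, e1, e2⟩
      · intro hz
        rw [hz, dotProduct_zero] at e1 e2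
        exact h0 ⟨e1.symm, e2.symm⟩
      · intro h; simpa using congrFun h 0
  obtain ⟨P, hP, hP'⟩ := exists_GL_mulVec_vecMul hx hy hv hn0 h1
  obtain ⟨X, hX, hX'⟩ := exists_GL_mulVec_vecMul (y := (c⁻¹ : F) • (ρ ∘ y)) hx
    (smul_ne_zero (inv_ne_zero c.ne_zero) (ringAut_comp_ne_zero ρ hy)) hu hl
    (by rw [smul_dotProduct, h2, smul_eq_mul, inv_mul_cancel_left₀ c.ne_zero])
  have h5 : m ᵥ* (entrywise F ρ P : Matrix (Fin 2) (Fin 2) F) = ρ ∘ y := by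
    rw [coe_entrywise, ← hP', ringAut_comp_vecMul, hn, ringAut_comp_symm_comp]
  refine not_agree_of_mulVec hc X P (hag _ ?_ _ ?_)
  · change _ = _
    rw [Units.val_mul, ← Matrix.mulVec_mulVec, mulVec_inv_eq hP, hX]
  · change _ = _
    rw [Units.val_mul, Units.val_mul, ← Matrix.vecMul_vecMul, ← Matrix.vecMul_vecMul,
      hX', vecMul_scalar, smul_inv_smul₀ c.ne_zero, vecMul_inv_eq h5]

/-! ### Sizes of slices -/

/-- Matrices that agree pairwise form part of a vertical or a horizontal slice. -/
theorem subset_Vert_or_Hor_of_agree {𝒮 : Set (GL (Fin 2) F)}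
    (h : ∀ A ∈ 𝒮, ∀ B ∈ 𝒮, Agree 1 A B) :
    (∃ v u : Fin 2 → F, v ≠ 0 ∧ u ≠ 0 ∧ 𝒮 ⊆ Vert v u) ∨
      (∃ l m : Fin 2 → F, l ≠ 0 ∧ m ≠ 0 ∧ 𝒮 ⊆ Hor l m) := by
  rcases 𝒮.eq_empty_or_nonempty with rfl | ⟨A₀, h₀⟩
  · exact Or.inl ⟨![1, 0], ![1, 0], by simp, by simp, Set.empty_subset _⟩
  have hdet : ∀ A ∈ 𝒮, ∀ B ∈ 𝒮,
      ((A : Matrix (Fin 2) (Fin 2) F) - (B : Matrix (Fin 2) (Fin 2) F)).det = 0 := by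
    intro A hA B hB
    obtain ⟨w, hw, hAB⟩ := h A hA B hB
    refine Matrix.exists_mulVec_eq_zero_iff.1 ⟨w, hw, ?_⟩
    rw [Matrix.sub_mulVec, hAB, sub_eq_zero]
    rfl
  have := common_kernel_of_det_sub_eq_zero (𝒩 := (fun A : GL (Fin 2) F =>
    (A : Matrix (Fin 2) (Fin 2) F) - (A₀ : Matrix (Fin 2) (Fin 2) F)) '' 𝒮)
    ⟨A₀, h₀, sub_self _⟩ (by
      rintro _ ⟨A, hA, rfl⟩ _ ⟨B, hB, rfl⟩
      simpa using hdet A hA B hB)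
  rcases this with ⟨v, hv, hN⟩ | ⟨l, hl, hN⟩
  · have hs : 𝒮 ⊆ Vert v ((A₀ : Matrix (Fin 2) (Fin 2) F) *ᵥ v) := by
      intro A hA
      have := hN _ ⟨A, hA, rfl⟩
      rwa [Matrix.sub_mulVec, sub_eq_zero] at this
    exact Or.inl ⟨v, _, hv, ne_zero_of_mem_Vert hv (hs h₀), hs⟩
  · have hs : 𝒮 ⊆ Hor l (l ᵥ* (A₀ : Matrix (Fin 2) (Fin 2) F)) := by
      intro A hA
      have := hN _ ⟨A, hA, rfl⟩
      rwa [Matrix.vecMul_sub, sub_eq_zero] at this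
    exact Or.inr ⟨l, _, hl, ne_zero_of_mem_Hor hl (hs h₀), hs⟩

/-- Changing bases in source and target reduces to the matrices fixing the first basis vector, which
are parametrized by their second column. -/
theorem ncard_Vert [Finite F] {v u : Fin 2 → F} (hv : v ≠ 0) (hu : u ≠ 0) :
    (Vert v u).ncard = Nat.card F * (Nat.card F - 1) := by
  have e1 : (![1, 0] : Fin 2 → F) ≠ 0 := by simp
  obtain ⟨P, hP⟩ := exists_GL_mulVec e1 hv
  obtain ⟨Q, hQ⟩ := exists_GL_mulVec e1 hu
  let f : F × Fˣ → GL (Fin 2) F := fun p => Q * upper 1 p.2 p.1 * P⁻¹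
  have hf : Function.Injective f := by
    rintro ⟨z, y⟩ ⟨z', y'⟩ h
    have h' : upper 1 y z = upper 1 y' z' := by simpa [f] using h
    have h'' := congrArg Units.val h'
    have h01 := congrFun (congrFun h'' 0) 1
    have h11 := congrFun (congrFun h'' 1) 1
    simp [upper, Matrix.GeneralLinearGroup.mkOfDetNeZero] at h01 h11
    ext <;> simp [h01, h11]
  have hr : Vert v u = Set.range f := by
    ext A
    constructor
    · intro hA
      have h1 : ((Q⁻¹ * A * P : GL (Fin 2) F) : Matrix (Fin 2) (Fin 2) F) *ᵥ ![1, 0]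
          = ![1, 0] := by
        rw [Units.val_mul, Units.val_mul, ← Matrix.mulVec_mulVec, ← Matrix.mulVec_mulVec, hP,
          show _ = u from hA, mulVec_inv_eq hQ]
      set B := Q⁻¹ * A * P with hB
      have h00 : B.val 0 0 = 1 := by simpa [Matrix.mulVec, dotProduct] using congrFun h1 0
      have h10 : B.val 1 0 = 0 := by simpa [Matrix.mulVec, dotProduct] using congrFun h1 1
      have hd : B.val 1 1 ≠ 0 := by
        have := (Matrix.GeneralLinearGroup.det B).ne_zero
        rw [Matrix.GeneralLinearGroup.val_det_apply, Matrix.det_fin_two, h00, h10] at this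
        simpa using this
      refine ⟨(B.val 0 1, Units.mk0 _ hd), ?_⟩
      have : upper 1 (Units.mk0 _ hd) (B.val 0 1) = B := by
        ext i j
        fin_cases i <;> fin_cases j <;>
          simp [upper, Matrix.GeneralLinearGroup.mkOfDetNeZero, h00, h10]
      simp only [f]
      rw [this, hB]
      group
    · rintro ⟨⟨z, y⟩, rfl⟩
      change _ = _
      simp only [f]
      rw [Units.val_mul, Units.val_mul, ← Matrix.mulVec_mulVec, ← Matrix.mulVec_mulVec,
        mulVec_inv_eq hP, ← hQ]
      congr 1
      ext i
      fin_cases i <;> simp [upper, Matrix.GeneralLinearGroup.mkOfDetNeZero]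
  rw [hr, Set.ncard_range_of_injective hf, Nat.card_prod, Nat.card_units]

theorem ncard_Hor [Finite F] {l m : Fin 2 → F} (hl : l ≠ 0) (hm : m ≠ 0) :
    (Hor l m).ncard = Nat.card F * (Nat.card F - 1) := by
  have hinv : Function.Involutive (transposeGL (F := F)) := transposeGL_transposeGL
  rw [Hor_eq_preimage_Vert, ← Set.image_eq_preimage_of_inverse hinv.leftInverse
    hinv.rightInverse, Set.ncard_image_of_injective _ hinv.injective, ncard_Vert hl hm]

end Slices

/-! ### The group generated by the Frobenius automorphism -/

section Frobenius

theorem pos_of_card_eq {F : Type*} [Field F] [Finite F] {k : ℕ} (hF : Nat.card F = 2 ^ k) : 0 < k := by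
  rcases Nat.eq_zero_or_pos k with rfl | h
  · have := Finite.one_lt_card (α := F)
    rw [hF] at this
    simp at this
  · exact h

theorem card_units_eq {F : Type*} [Field F] {k : ℕ} (hF : Nat.card F = 2 ^ k) : Nat.card Fˣ = 2 ^ k - 1 := by
  rw [Nat.card_units, hF]

variable {F : Type*} [Field F] [Finite F] [CharP F 2]

theorem frob_pow_apply (n : ℕ) (x : F) : (frob 2 F ^ n) x = x ^ 2 ^ n := by
  rw [← iterateFrobeniusEquiv_eq_pow, iterateFrobeniusEquiv_def]

theorem orderOf_frob {k : ℕ} (hF : Nat.card F = 2 ^ k) : orderOf (frob 2 F) = k := by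
  have hk := pos_of_card_eq hF
  rw [orderOf_eq_iff hk]
  constructor
  · ext x
    rw [frob_pow_apply, ← hF]
    have := Fintype.ofFinite F
    rw [Nat.card_eq_fintype_card, FiniteField.pow_card]
    rfl
  · intro m hm hm0 h
    obtain ⟨u, hu⟩ := IsCyclic.exists_generator (α := Fˣ)
    have ho : orderOf u = 2 ^ k - 1 := by
      rw [orderOf_eq_card_of_forall_mem_zpowers hu, card_units_eq hF]
    have h1 : (u : F) ^ 2 ^ m = u := by
      rw [← frob_pow_apply, h]; rfl
    have h2 : u ^ (2 ^ m - 1) = 1 := by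
      have h3 : u ^ 2 ^ m = u := by ext; simpa using h1
      have h4 : 2 ^ m = (2 ^ m - 1) + 1 := (Nat.sub_add_cancel Nat.one_le_two_pow).symm
      rw [h4, pow_succ] at h3
      exact mul_eq_right.1 h3
    have h5 := Nat.le_of_dvd (Nat.sub_pos_of_lt (Nat.one_lt_two_pow hm0.ne'))
      (ho ▸ orderOf_dvd_of_pow_eq_one h2)
    have h6 : 2 ^ m < 2 ^ k := Nat.pow_lt_pow_right one_lt_two hm
    have h7 : 1 ≤ 2 ^ m := Nat.one_le_two_pow
    omega

theorem card_zpowers_frob {k : ℕ} (hF : Nat.card F = 2 ^ k) :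
    Nat.card (Subgroup.zpowers (frob 2 F)) = k := by
  rw [Nat.card_zpowers, orderOf_frob hF]

theorem exists_pow_frob_eq {k : ℕ} (hF : Nat.card F = 2 ^ k)
    (σ : Subgroup.zpowers (frob 2 F)) :
    ∃ j < k, σ = (⟨frob 2 F, Subgroup.mem_zpowers _⟩ : Subgroup.zpowers (frob 2 F)) ^ j := by
  obtain ⟨σ, hσ⟩ := σ
  obtain ⟨n, hn⟩ := (isOfFinOrder_of_finite _).mem_powers_iff_mem_zpowers.2 hσ
  refine ⟨n % k, Nat.mod_lt _ (pos_of_card_eq hF), ?_⟩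
  ext1
  rw [Subgroup.coe_pow, ← orderOf_frob hF, pow_mod_orderOf]
  exact hn.symm

theorem frob_pow_injOn {k : ℕ} (hF : Nat.card F = 2 ^ k) {i j : ℕ} (hi : i < k) (hj : j < k)
    (h : (⟨frob 2 F, Subgroup.mem_zpowers _⟩ : Subgroup.zpowers (frob 2 F)) ^ i
      = (⟨frob 2 F, Subgroup.mem_zpowers _⟩ : Subgroup.zpowers (frob 2 F)) ^ j) : i = j := by
  have h' := congrArg Subtype.val h
  simp only [Subgroup.coe_pow] at h'
  refine pow_injOn_Iio_orderOf ?_ ?_ h' <;> rw [orderOf_frob hF] <;> assumption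

/-- φ^p fixes the subfield of order 2^p, which contains more than 0 and 1. A unit of prime order
dividing 2^p - 1, supplied by Cauchy's theorem, is an explicit fixed point. -/
theorem hasObstruction_frob_pow_zpow {k p : ℕ} (hF : Nat.card F = 2 ^ k) (hp : p.Prime)
    (hpk : p ∣ k) (n : ℤ) : HasObstruction ((frob 2 F ^ p) ^ n) := by
  have hr : (Nat.minFac (2 ^ p - 1)).Prime := Nat.minFac_prime (by
    have : 2 ^ 2 ≤ 2 ^ p := Nat.pow_le_pow_right two_pos hp.two_le
    omega)
  have hd : Nat.minFac (2 ^ p - 1) ∣ Nat.card Fˣ := by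
    rw [card_units_eq hF]
    exact (Nat.minFac_dvd _).trans (Nat.pow_sub_one_dvd_pow_sub_one 2 hpk)
  have := Fact.mk hr
  obtain ⟨x, hx⟩ := exists_prime_orderOf_dvd_card' _ hd
  have h1 : x ^ 2 ^ p = x := by
    have h4 : 2 ^ p = (2 ^ p - 1) + 1 := (Nat.sub_add_cancel Nat.one_le_two_pow).symm
    rw [h4, pow_succ, orderOf_dvd_iff_pow_eq_one.1 (hx ▸ Nat.minFac_dvd _), one_mul]
  have h2 : (frob 2 F ^ p) (x : F) = x := by
    rw [frob_pow_apply, ← Units.val_pow_eq_pow_val, h1]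
  refine hasObstruction_of_fixed x.ne_zero (fun h => ?_)
    (zpow_mem (show frob 2 F ^ p ∈ MulAction.stabilizer (RingAut F) (x : F) from h2) n)
  rw [Units.val_eq_one.1 h, orderOf_one] at hx
  exact hr.one_lt.ne hx

/-- If `k` is not a prime power, every power of the Frobenius automorphism is a product of two
that are trivial or fix a proper extension of the prime field. -/
theorem exists_mul_hasObstruction {k : ℕ} (hk : ¬ IsPrimePow k) (hF : Nat.card F = 2 ^ k)
    (σ : Subgroup.zpowers (frob 2 F)) :
    ∃ ρ₁ ρ₂ : Subgroup.zpowers (frob 2 F), σ = ρ₂ * ρ₁ ∧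
      (ρ₁ = 1 ∨ HasObstruction (ρ₁ : RingAut F)) ∧
      (ρ₂ = 1 ∨ HasObstruction (ρ₂ : RingAut F)) := by
  -- For k = 1 there is no prime divisor to use, but the group is trivial.
  by_cases hk1 : k = 1
  · obtain ⟨j, hj, rfl⟩ := exists_pow_frob_eq hF σ
    obtain rfl : j = 0 := by omega
    exact ⟨1, 1, by simp, Or.inl rfl, Or.inl rfl⟩
  have hp := Nat.minFac_prime hk1
  obtain ⟨r, hr, hrk, hne⟩ : ∃ r : ℕ, r.Prime ∧ r ∣ k ∧ r ≠ k.minFac := by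
    by_contra! h
    exact hk (isPrimePow_iff_unique_prime_dvd.2
      ⟨k.minFac, ⟨hp, Nat.minFac_dvd k⟩, fun r hr => h r hr.1 hr.2⟩)
  obtain ⟨a, b, hab⟩ := Nat.isCoprime_iff_coprime.2 ((Nat.coprime_primes hr hp).2 hne)
  obtain ⟨σ, n, rfl⟩ := σ
  refine ⟨⟨(frob 2 F ^ k.minFac) ^ (b * n), ?_⟩, ⟨(frob 2 F ^ r) ^ (a * n), ?_⟩, ?_,
    Or.inr (hasObstruction_frob_pow_zpow hF hp (Nat.minFac_dvd k) _),
    Or.inr (hasObstruction_frob_pow_zpow hF hr hrk _)⟩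
  · exact zpow_mem (pow_mem (Subgroup.mem_zpowers _) _) _
  · exact zpow_mem (pow_mem (Subgroup.mem_zpowers _) _) _
  · ext1
    change frob 2 F ^ n = (frob 2 F ^ r) ^ (a * n) * (frob 2 F ^ k.minFac) ^ (b * n)
    rw [← zpow_natCast, ← zpow_natCast, ← zpow_mul, ← zpow_mul, ← zpow_add]
    congr 1
    linear_combination (-n) * hab

end Frobenius

/-! ### Slices of sets of semilinear maps -/

section GroupSlices

variable {F : Type*} [Field F] [Finite F] [CharP F 2]

/-- The matrices `A` with `A σ` in `S`. -/
def slice (S : Set (GammaL 2 F)) (σ : Subgroup.zpowers (frob 2 F)) : Set (GL (Fin 2) F) :=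
  {A | (⟨A, σ⟩ : GammaL 2 F) ∈ S}

theorem mem_slice {S : Set (GammaL 2 F)} {σ : Subgroup.zpowers (frob 2 F)}
    {A : GL (Fin 2) F} : A ∈ slice S σ ↔ (⟨A, σ⟩ : GammaL 2 F) ∈ S := Iff.rfl

theorem ext_slice {S T : Set (GammaL 2 F)} (h : ∀ σ, slice S σ = slice T σ) : S = T := by
  ext ⟨A, σ⟩
  rw [← mem_slice, h, mem_slice]

theorem coe_smul_nonzeroVec (g : GammaL 2 F) (w : NonzeroVec F) :
    ((g • w : NonzeroVec F) : Fin 2 → F)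
      = (g.left : Matrix (Fin 2) (Fin 2) F) *ᵥ ((g.right : RingAut F) ∘ (w : Fin 2 → F)) := rfl

/-- Substituting σ(w) for w turns the comparison of Aσ with Bτ into that of A with Bτσ⁻¹. -/
theorem exists_smul_eq_iff_agree (A B : GL (Fin 2) F) (σ τ : Subgroup.zpowers (frob 2 F)) :
    (∃ w : NonzeroVec F, (⟨A, σ⟩ : GammaL 2 F) • w = (⟨B, τ⟩ : GammaL 2 F) • w) ↔
      Agree ((τ * σ⁻¹ : Subgroup.zpowers (frob 2 F)) : RingAut F) A B := by
  constructor
  · rintro ⟨w, hw⟩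
    refine ⟨(σ : RingAut F) ∘ w.1, ringAut_comp_ne_zero _ w.2, ?_⟩
    have := congrArg Subtype.val hw
    rw [coe_smul_nonzeroVec, coe_smul_nonzeroVec] at this
    rw [this]
    congr 1
    ext i
    change (τ : RingAut F) _ = (τ : RingAut F) ((σ : RingAut F).symm ((σ : RingAut F) _))
    rw [RingEquiv.symm_apply_apply]
  · rintro ⟨w, hw, h⟩
    refine ⟨⟨(σ : RingAut F).symm ∘ w, ringAut_comp_ne_zero _ hw⟩, ?_⟩
    ext1
    rw [coe_smul_nonzeroVec, coe_smul_nonzeroVec]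
    simp only
    rw [ringAut_comp_symm_comp, h]
    rfl

theorem isIntersecting_iff_agree {S : Set (GammaL 2 F)} :
    IsIntersecting (NonzeroVec F) S ↔ ∀ σ τ, ∀ A ∈ slice S σ, ∀ B ∈ slice S τ,
      Agree ((τ * σ⁻¹ : Subgroup.zpowers (frob 2 F)) : RingAut F) A B := by
  constructor
  · intro h σ τ A hA B hB
    exact (exists_smul_eq_iff_agree A B σ τ).1 (h _ hA _ hB)
  · rintro h ⟨A, σ⟩ hA ⟨B, τ⟩ hB
    exact (exists_smul_eq_iff_agree A B σ τ).2 (h σ τ A hA B hB)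

theorem ncard_eq_sum_slice [Fintype (Subgroup.zpowers (frob 2 F))] (S : Set (GammaL 2 F)) :
    S.ncard = ∑ σ, (slice S σ).ncard := by
  let e : S ≃ Σ σ : Subgroup.zpowers (frob 2 F), slice S σ :=
    { toFun := fun g => ⟨g.1.right, g.1.left, g.2⟩
      invFun := fun x => ⟨⟨x.2.1, x.1⟩, x.2.2⟩
      left_inv := fun _ => rfl
      right_inv := fun _ => rfl }
  rw [← Nat.card_coe_set_eq, Nat.card_congr e, Nat.card_sigma]
  rfl

theorem ncard_eq_of_slices {k n : ℕ} (hF : Nat.card F = 2 ^ k) {S : Set (GammaL 2 F)}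
    (h : ∀ σ, (slice S σ).ncard = n) : S.ncard = k * n := by
  have := Fintype.ofFinite (Subgroup.zpowers (frob 2 F))
  rw [ncard_eq_sum_slice, Finset.sum_congr rfl (fun σ _ => h σ), Finset.sum_const,
    Finset.card_univ, ← Nat.card_eq_fintype_card, card_zpowers_frob hF, smul_eq_mul]

theorem IsIntersecting.slice_subset {S : Set (GammaL 2 F)}
    (hS : IsIntersecting (NonzeroVec F) S) (σ : Subgroup.zpowers (frob 2 F)) :
    (∃ v u : Fin 2 → F, v ≠ 0 ∧ u ≠ 0 ∧ slice S σ ⊆ Vert v u) ∨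
      (∃ l m : Fin 2 → F, l ≠ 0 ∧ m ≠ 0 ∧ slice S σ ⊆ Hor l m) :=
  subset_Vert_or_Hor_of_agree fun A hA B hB => by
    simpa using isIntersecting_iff_agree.1 hS σ σ A hA B hB

theorem IsIntersecting.ncard_slice_le {S : Set (GammaL 2 F)}
    (hS : IsIntersecting (NonzeroVec F) S) (σ : Subgroup.zpowers (frob 2 F)) :
    (slice S σ).ncard ≤ Nat.card F * (Nat.card F - 1) := by
  rcases hS.slice_subset σ with ⟨v, u, hv, hu, h⟩ | ⟨l, m, hl, hm, h⟩
  · rw [← ncard_Vert hv hu]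
    exact Set.ncard_le_ncard h (Set.toFinite _)
  · rw [← ncard_Hor hl hm]
    exact Set.ncard_le_ncard h (Set.toFinite _)

/-! ### The size bound and the case of equality -/

theorem IsIntersecting.ncard_le {k : ℕ} (hF : Nat.card F = 2 ^ k) {S : Set (GammaL 2 F)}
    (hS : IsIntersecting (NonzeroVec F) S) :
    S.ncard ≤ k * (Nat.card F * (Nat.card F - 1)) := by
  have := Fintype.ofFinite (Subgroup.zpowers (frob 2 F))
  rw [ncard_eq_sum_slice]
  refine (Finset.sum_le_card_nsmul _ _ _ fun σ _ => hS.ncard_slice_le σ).trans_eq ?_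
  rw [Finset.card_univ, ← Nat.card_eq_fintype_card, card_zpowers_frob hF, smul_eq_mul]

theorem slice_stabilizer (w : NonzeroVec F) (σ : Subgroup.zpowers (frob 2 F)) :
    slice (MulAction.stabilizer (GammaL 2 F) w : Set (GammaL 2 F)) σ
      = Vert ((σ : RingAut F) ∘ (w : Fin 2 → F)) w := by
  ext A
  change _ • _ = _ ↔ _ = _
  rw [← coe_smul_nonzeroVec (⟨A, σ⟩ : GammaL 2 F) w, Subtype.ext_iff]

theorem ncard_stabilizer {k : ℕ} (hF : Nat.card F = 2 ^ k) (w : NonzeroVec F) :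
    (MulAction.stabilizer (GammaL 2 F) w : Set (GammaL 2 F)).ncard
      = k * (Nat.card F * (Nat.card F - 1)) :=
  ncard_eq_of_slices hF fun σ => by
    rw [slice_stabilizer, ncard_Vert (ringAut_comp_ne_zero _ w.2) w.2]

theorem isIntersecting_stabilizer (w : NonzeroVec F) :
    IsIntersecting (NonzeroVec F)
      (MulAction.stabilizer (GammaL 2 F) w : Set (GammaL 2 F)) := by
  intro g hg h hh
  exact ⟨w, (show g • w = w from hg).trans (show h • w = w from hh).symm⟩

theorem isMaximumIntersecting_iff {k : ℕ} (hF : Nat.card F = 2 ^ k) {S : Set (GammaL 2 F)} :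
    IsMaximumIntersecting (NonzeroVec F) S ↔ IsIntersecting (NonzeroVec F) S ∧
      S.ncard = k * (Nat.card F * (Nat.card F - 1)) := by
  constructor
  · rintro ⟨h, hmax⟩
    refine ⟨h, le_antisymm (h.ncard_le hF) ?_⟩
    rw [← ncard_stabilizer hF (⟨![1, 0], by simp⟩ : NonzeroVec F)]
    exact hmax _ (isIntersecting_stabilizer _)
  · rintro ⟨h, hc⟩
    exact ⟨h, fun T hT => hc ▸ hT.ncard_le hF⟩

/-- Equality in the sum over slices forces equality in each term, so every slice fills the `Vert` or
`Hor` that contains it. -/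
theorem IsMaximumIntersecting.slice_eq {k : ℕ} (hF : Nat.card F = 2 ^ k)
    {S : Set (GammaL 2 F)} (hS : IsMaximumIntersecting (NonzeroVec F) S)
    (σ : Subgroup.zpowers (frob 2 F)) :
    (∃ v u : Fin 2 → F, v ≠ 0 ∧ u ≠ 0 ∧ slice S σ = Vert v u) ∨
      (∃ l m : Fin 2 → F, l ≠ 0 ∧ m ≠ 0 ∧ slice S σ = Hor l m) := by
  have hcard : (slice S σ).ncard = Nat.card F * (Nat.card F - 1) := by
    have := Fintype.ofFinite (Subgroup.zpowers (frob 2 F))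
    have h := ((isMaximumIntersecting_iff hF).1 hS).2
    rw [ncard_eq_sum_slice] at h
    refine (Finset.sum_eq_sum_iff_of_le (f := fun σ => (slice S σ).ncard)
      (g := fun _ => Nat.card F * (Nat.card F - 1))
      fun σ _ => hS.1.ncard_slice_le σ).1 ?_ σ (Finset.mem_univ σ)
    rw [h, Finset.sum_const, Finset.card_univ, ← Nat.card_eq_fintype_card,
      card_zpowers_frob hF, smul_eq_mul]
  rcases hS.1.slice_subset σ with ⟨v, u, hv, hu, h⟩ | ⟨l, m, hl, hm, h⟩
  · exact Or.inl ⟨v, u, hv, hu, Set.eq_of_subset_of_ncard_le h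
      (by rw [hcard, ncard_Vert hv hu]) (Set.toFinite _)⟩
  · exact Or.inr ⟨l, m, hl, hm, Set.eq_of_subset_of_ncard_le h
      (by rw [hcard, ncard_Hor hl hm]) (Set.toFinite _)⟩

end GroupSlices

/-! ### Slices of a maximum intersecting set over different automorphisms -/

section Structure

/-- Needed when the vertical slice lies over ρσ and the horizontal one over σ, so that agreement has
to be read backwards. -/
theorem HasObstruction.inv {F : Type*} [Field F] {ρ : RingAut F} (h : HasObstruction ρ) :
    HasObstruction ρ⁻¹ := by
  obtain ⟨c, hc⟩ := h
  refine ⟨Units.map (ρ.symm : F →* F) c⁻¹, fun x hx => hc x ?_⟩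
  have hx' : ρ x = c⁻¹ * x := by
    conv_lhs => rw [hx]
    rw [map_mul]
    congr 1
    · exact ρ.apply_symm_apply _
    · exact ρ.apply_symm_apply _
  rw [hx', Units.mul_inv_cancel_left]

variable {F : Type*} [Field F] [Finite F] [CharP F 2]

theorem IsIntersecting.agree_mul {S : Set (GammaL 2 F)} (hS : IsIntersecting (NonzeroVec F) S)
    (σ ρ : Subgroup.zpowers (frob 2 F)) :
    ∀ A ∈ slice S σ, ∀ B ∈ slice S (ρ * σ), Agree (ρ : RingAut F) A B := fun A hA B hB => by
  simpa using isIntersecting_iff_agree.1 hS σ (ρ * σ) A hA B hB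

theorem IsIntersecting.agree_mul_inv {S : Set (GammaL 2 F)}
    (hS : IsIntersecting (NonzeroVec F) S) (σ ρ : Subgroup.zpowers (frob 2 F)) :
    ∀ A ∈ slice S (ρ * σ), ∀ B ∈ slice S σ, Agree (ρ : RingAut F)⁻¹ A B := fun A hA B hB => by
  simpa using isIntersecting_iff_agree.1 hS (ρ * σ) σ A hA B hB

/-- The slice of `S` over `σ` consists of all maps over `σ` that send `v` to a fixed multiple
of `v`. -/
def IsVertSlice (S : Set (GammaL 2 F)) (v : Fin 2 → F) (σ : Subgroup.zpowers (frob 2 F)) :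
    Prop :=
  ∃ a : Fˣ, slice S σ = Vert ((σ : RingAut F) ∘ v) ((a : F) • v)

/-- The slice of `S` over `σ` consists of all maps over `σ` that pull the functional `l` back to
a fixed multiple of `l`. -/
def IsHorSlice (S : Set (GammaL 2 F)) (l : Fin 2 → F) (σ : Subgroup.zpowers (frob 2 F)) :
    Prop :=
  ∃ a : Fˣ, slice S σ = Hor l ((a : F) • ((σ : RingAut F) ∘ l))

theorem eq_smul_comp_of_det₂ {ρ σ : Subgroup.zpowers (frob 2 F)} {v v' : Fin 2 → F}
    (hv : v ≠ 0) (hv' : v' ≠ 0)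
    (h : det₂ ((σ : RingAut F) ∘ v) ((ρ : RingAut F).symm ∘ v') = 0) :
    ∃ b : F, b ≠ 0 ∧ v' = b • (((ρ * σ : Subgroup.zpowers (frob 2 F)) : RingAut F) ∘ v) := by
  obtain ⟨b, hb⟩ := exists_smul_of_det₂_eq_zero (ringAut_comp_ne_zero _ hv) h
  have h' : v' = (ρ : RingAut F) b •
      (((ρ * σ : Subgroup.zpowers (frob 2 F)) : RingAut F) ∘ v) := by
    have := congrArg (fun w : Fin 2 → F => (ρ : RingAut F) ∘ w) hb
    simp only [ringAut_comp_symm_comp, ringAut_comp_smul] at this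
    rw [this]
    rfl
  exact ⟨_, smul_ne_zero_of_eq hv' h', h'⟩

/-- One step of the propagation: the known slice over σ forces the one over ρσ to be vertical and
aligned with it. -/
theorem IsVertSlice.mul {k : ℕ} (hF : Nat.card F = 2 ^ k) {S : Set (GammaL 2 F)}
    (hS : IsMaximumIntersecting (NonzeroVec F) S) {v : Fin 2 → F} (hv : v ≠ 0)
    {ρ σ : Subgroup.zpowers (frob 2 F)} (hρ : ρ = 1 ∨ HasObstruction (ρ : RingAut F))
    (h : IsVertSlice S v σ) : IsVertSlice S v (ρ * σ) := by
  by_cases h1 : ρ = 1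
  · rwa [h1, one_mul]
  have hobs := hρ.resolve_left h1
  have h1' : (ρ : RingAut F) ≠ 1 := fun h => h1 (Subtype.ext h)
  obtain ⟨a, ha⟩ := h
  have hσv := ringAut_comp_ne_zero (σ : RingAut F) hv
  have hav : (a : F) • v ≠ 0 := smul_ne_zero a.ne_zero hv
  have hag := hS.1.agree_mul σ ρ
  rw [ha] at hag
  rcases hS.slice_eq hF (ρ * σ) with ⟨v', u', hv', hu', h'⟩ | ⟨l, m, hl, hm, h'⟩
  · rw [h'] at hag
    obtain ⟨e1, e2⟩ := parallel_of_agree_Vert_Vert h1' hobs hσv hav hv' hu' hag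
    obtain ⟨b, hb, rfl⟩ := eq_smul_comp_of_det₂ hv hv' e1
    obtain ⟨d, rfl⟩ := exists_smul_of_det₂_eq_zero hav e2
    have hd : d ≠ 0 := smul_ne_zero_of_eq hu' rfl
    refine ⟨Units.mk0 (d * a / b) (div_ne_zero (mul_ne_zero hd a.ne_zero) hb), ?_⟩
    rw [h', smul_smul, Vert_smul hb]
    rfl
  · rw [h'] at hag
    exact absurd hag (not_agree_Vert_Hor h1' hobs hσv hav hl hm)

theorem IsHorSlice.mul {k : ℕ} (hF : Nat.card F = 2 ^ k) {S : Set (GammaL 2 F)}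
    (hS : IsMaximumIntersecting (NonzeroVec F) S) {l : Fin 2 → F} (hl : l ≠ 0)
    {ρ σ : Subgroup.zpowers (frob 2 F)} (hρ : ρ = 1 ∨ HasObstruction (ρ : RingAut F))
    (h : IsHorSlice S l σ) : IsHorSlice S l (ρ * σ) := by
  by_cases h1 : ρ = 1
  · rwa [h1, one_mul]
  have hobs := hρ.resolve_left h1
  have h1' : (ρ : RingAut F) ≠ 1 := fun h => h1 (Subtype.ext h)
  obtain ⟨a, ha⟩ := h
  have hσl := ringAut_comp_ne_zero (σ : RingAut F) hl
  have hal : (a : F) • ((σ : RingAut F) ∘ l) ≠ 0 := smul_ne_zero a.ne_zero hσl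
  rcases hS.slice_eq hF (ρ * σ) with ⟨v, u, hv, hu, h'⟩ | ⟨l', m', hl', hm', h'⟩
  · have hag := hS.1.agree_mul_inv σ ρ
    rw [ha, h'] at hag
    exact absurd hag (not_agree_Vert_Hor (inv_ne_one.2 h1') hobs.inv hv hu hl hal)
  · have hag := hS.1.agree_mul σ ρ
    rw [ha, h'] at hag
    obtain ⟨e1, e2⟩ := parallel_of_agree_Hor_Hor h1' hobs hl hal hl' hm' hag
    have e1' : det₂ ((σ : RingAut F) ∘ l) ((ρ : RingAut F).symm ∘ m') = 0 := by
      have : det₂ ((a : F) • ((σ : RingAut F) ∘ l)) ((ρ : RingAut F).symm ∘ m')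
          = a * det₂ ((σ : RingAut F) ∘ l) ((ρ : RingAut F).symm ∘ m') := by
        simp only [det₂, Pi.smul_apply, smul_eq_mul]; ring
      rw [this] at e1
      exact (mul_eq_zero.1 e1).resolve_left a.ne_zero
    obtain ⟨b, hb, rfl⟩ := eq_smul_comp_of_det₂ hl hm' e1'
    obtain ⟨d, rfl⟩ := exists_smul_of_det₂_eq_zero hl e2
    have hd : d ≠ 0 := smul_ne_zero_of_eq hl' rfl
    refine ⟨Units.mk0 (b / d) (div_ne_zero hb hd), ?_⟩
    rw [h', Hor_smul hd]
    rfl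

/-- A maximum intersecting set that contains the identity is vertical with respect to a vector
or horizontal with respect to a functional. -/
theorem IsMaximumIntersecting.isVertSlice_or_isHorSlice {k : ℕ} (hk : ¬ IsPrimePow k)
    (hF : Nat.card F = 2 ^ k) {S : Set (GammaL 2 F)}
    (hS : IsMaximumIntersecting (NonzeroVec F) S) (h1 : 1 ∈ S) :
    (∃ v : Fin 2 → F, v ≠ 0 ∧ ∀ σ, IsVertSlice S v σ) ∨
      (∃ l : Fin 2 → F, l ≠ 0 ∧ ∀ σ, IsHorSlice S l σ) := by
  have h1' : (1 : GL (Fin 2) F) ∈ slice S 1 := h1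
  rcases hS.slice_eq hF 1 with ⟨v, u, hv, hu, h⟩ | ⟨l, m, hl, hm, h⟩
  · obtain rfl : v = u := by
      rw [h] at h1'
      simpa using show _ = u from h1'
    refine Or.inl ⟨v, hv, fun σ => ?_⟩
    -- Two steps, from 1 to ρ₁ and from ρ₁ to ρ₂ρ₁, each along an automorphism that is trivial or
    -- obstructed.
    obtain ⟨ρ₁, ρ₂, rfl, hρ₁, hρ₂⟩ := exists_mul_hasObstruction hk hF σ
    have h₁ : IsVertSlice S v 1 := ⟨1, by rw [h, Units.val_one, one_smul]; rfl⟩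
    have h₂ := h₁.mul hF hS hv hρ₁
    rw [mul_one] at h₂
    exact h₂.mul hF hS hv hρ₂
  · obtain rfl : l = m := by
      rw [h] at h1'
      simpa using show _ = m from h1'
    refine Or.inr ⟨l, hl, fun σ => ?_⟩
    obtain ⟨ρ₁, ρ₂, rfl, hρ₁, hρ₂⟩ := exists_mul_hasObstruction hk hF σ
    have h₁ : IsHorSlice S l 1 := ⟨1, by rw [h, Units.val_one, one_smul]; rfl⟩
    have h₂ := h₁.mul hF hS hl hρ₁
    rw [mul_one] at h₂
    exact h₂.mul hF hS hl hρ₂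

/-! ### Invariant lines and conjugation -/

theorem mem_upperTriangular_iff {g : GammaL 2 F} :
    g ∈ upperTriangular 2 F ↔ (g.left : Matrix (Fin 2) (Fin 2) F) 1 0 = 0 := by
  constructor
  · rintro ⟨x, y, z, j, rfl⟩
    simp [ofGL, phiPow, upper, Matrix.GeneralLinearGroup.mkOfDetNeZero]
  · intro h
    obtain ⟨A, σ, hσ⟩ := g
    have hd := (Matrix.GeneralLinearGroup.det A).ne_zero
    simp only at h
    rw [Matrix.GeneralLinearGroup.val_det_apply, Matrix.det_fin_two, h, mul_zero, sub_zero] at hd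
    obtain ⟨j, hj⟩ := (isOfFinOrder_of_finite _).mem_powers_iff_mem_zpowers.2 hσ
    refine ⟨Units.mk0 _ (left_ne_zero_of_mul hd), Units.mk0 _ (right_ne_zero_of_mul hd),
      A.val 0 1, j, ?_⟩
    ext1
    · ext i j
      fin_cases i <;> fin_cases j <;>
        simp [ofGL, phiPow, upper, Matrix.GeneralLinearGroup.mkOfDetNeZero, h]
    · ext1
      simpa [ofGL, phiPow] using hj.symm

theorem semilin_smul (g : GammaL 2 F) (a : F) (v : Fin 2 → F) :
    semilin g (a • v) = (g.right : RingAut F) a • semilin g v := by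
  have : (fun i => (g.right : RingAut F) ((a • v) i))
      = (g.right : RingAut F) a • fun i => (g.right : RingAut F) (v i) := by
    ext i; simp
  rw [semilin, this, Matrix.mulVec_smul]
  rfl

theorem mem_upperTriangular_of_semilin {g : GammaL 2 F}
    (h : ∃ a : F, semilin g ![1, 0] = a • ![1, 0]) : g ∈ upperTriangular 2 F := by
  obtain ⟨a, ha⟩ := h
  rw [mem_upperTriangular_iff]
  have := congrFun ha 1
  simpa [semilin, Matrix.mulVec, dotProduct] using this

/-- In the vertical case the line is spanned by v; in the horizontal case it is the kernel of l, as
each element pulls l back to a multiple of a Galois conjugate of l. -/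
theorem IsMaximumIntersecting.exists_invariant_line {k : ℕ} (hk : ¬ IsPrimePow k)
    (hF : Nat.card F = 2 ^ k) {S : Set (GammaL 2 F)}
    (hS : IsMaximumIntersecting (NonzeroVec F) S) (h1 : 1 ∈ S) :
    ∃ v : Fin 2 → F, v ≠ 0 ∧ ∀ g ∈ S, ∃ a : F, semilin g v = a • v := by
  rcases hS.isVertSlice_or_isHorSlice hk hF h1 with ⟨v, hv, h⟩ | ⟨l, hl, h⟩
  · refine ⟨v, hv, fun g hg => ?_⟩
    obtain ⟨a, ha⟩ := h g.right
    have : g.left ∈ slice S g.right := hg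
    rw [ha] at this
    exact ⟨a, this⟩
  · have hv : (![- l 1, l 0] : Fin 2 → F) ≠ 0 := by
      intro h
      apply hl
      have := congrFun h 0
      have := congrFun h 1
      ext i; fin_cases i <;> simp_all
    refine ⟨_, hv, fun g hg => exists_smul_of_det₂_eq_zero hv ?_⟩
    obtain ⟨a, ha⟩ := h g.right
    have hm : g.left ∈ slice S g.right := hg
    rw [ha] at hm
    have e : det₂ ![- l 1, l 0] (semilin g ![- l 1, l 0])
        = - (l ⬝ᵥ semilin g ![- l 1, l 0]) := by
      simp only [det₂, dotProduct, Fin.sum_univ_two, Matrix.cons_val_zero, Matrix.cons_val_one]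
      ring
    rw [e, semilin, Matrix.dotProduct_mulVec, show _ = _ from hm]
    simp [dotProduct, Fin.sum_univ_two]
    ring

theorem IsIntersecting.image_conj {S : Set (GammaL 2 F)}
    (hS : IsIntersecting (NonzeroVec F) S) (f g : GammaL 2 F) :
    IsIntersecting (NonzeroVec F) ((fun s => g * (f⁻¹ * s) * g⁻¹) '' S) := by
  rintro _ ⟨s, hs, rfl⟩ _ ⟨t, ht, rfl⟩
  obtain ⟨w, hw⟩ := hS s hs t ht
  exact ⟨g • w, by simp [mul_smul, hw]⟩

theorem IsMaximumIntersecting.image_conj {k : ℕ} (hF : Nat.card F = 2 ^ k)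
    {S : Set (GammaL 2 F)} (hS : IsMaximumIntersecting (NonzeroVec F) S) (f g : GammaL 2 F) :
    IsMaximumIntersecting (NonzeroVec F) ((fun s => g * (f⁻¹ * s) * g⁻¹) '' S) := by
  rw [isMaximumIntersecting_iff hF] at hS ⊢
  refine ⟨hS.1.image_conj f g, ?_⟩
  rw [Set.ncard_image_of_injective _ (fun s t h => by simpa using h), hS.2]

theorem IsMaximumIntersecting.exists_conj_subset_upperTriangular {k : ℕ}
    (hk : ¬ IsPrimePow k) (hF : Nat.card F = 2 ^ k) {S : Set (GammaL 2 F)}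
    (hS : IsMaximumIntersecting (NonzeroVec F) S) {f : GammaL 2 F} (hf : f ∈ S) :
    ∃ g : GammaL 2 F, (fun s => g * (f⁻¹ * s) * g⁻¹) '' S ⊆ upperTriangular 2 F := by
  obtain ⟨v, hv, h⟩ := (hS.image_conj hF f 1).exists_invariant_line hk hF ⟨f, hf, by simp⟩
  obtain ⟨P, hP⟩ := exists_GL_mulVec hv (show (![1, 0] : Fin 2 → F) ≠ 0 by simp)
  have hg : semilin (ofGL 2 P : GammaL 2 F) v = ![1, 0] := by
    rw [← hP]
    simp [semilin, ofGL]
  have hg' : semilin (ofGL 2 P : GammaL 2 F)⁻¹ ![1, 0] = v := by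
    rw [← hg, ← semilin_mul, inv_mul_cancel, semilin_one]
  refine ⟨ofGL 2 P, ?_⟩
  rintro _ ⟨s, hs, rfl⟩
  obtain ⟨a, ha⟩ := h _ ⟨s, hs, rfl⟩
  simp only [one_mul, inv_one, mul_one] at ha
  apply mem_upperTriangular_of_semilin
  exact ⟨_, by rw [semilin_mul, hg', semilin_mul, ha, semilin_smul, hg]⟩

end Structure

/-! ### Exponents of a primitive element -/

section Exponents

/-- Since gcd(2^d - 1, 2^k - 1) = 2^gcd(d, k) - 1 = 1, the divisor is a unit. Thus the coprime
alternative in `Admissible` only names the cases where the congruence is automatic. -/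
theorem two_pow_sub_one_dvd_of_coprime {k d : ℕ} (h : Nat.gcd d k = 1) (x : ZMod (2 ^ k - 1)) :
    ((2 : ZMod (2 ^ k - 1)) ^ d - 1) ∣ x := by
  have hc : Nat.Coprime (2 ^ d - 1) (2 ^ k - 1) := by
    rw [Nat.Coprime, Nat.pow_sub_one_gcd_pow_sub_one, h, pow_one]
  have hu := (ZMod.isUnit_iff_coprime _ _).2 hc
  rw [Nat.cast_sub Nat.one_le_two_pow] at hu
  push_cast at hu
  exact hu.dvd

/-- Modulo 2^d - 1 the left difference is 2^i (b - a), and 2 is a unit because 2^k = 1. The twist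
arises because φ^j stands to the left of the matrix in `H`, so its corner ω^t becomes ω^(t 2^j). -/
theorem two_pow_sub_one_dvd_twist_iff {k : ℕ} (i d : ℕ) (hi : i ≤ k) (a b : ZMod (2 ^ k - 1)) :
    ((2 : ZMod (2 ^ k - 1)) ^ d - 1) ∣ (b * 2 ^ (i + d) - a * 2 ^ i) ↔
      ((2 : ZMod (2 ^ k - 1)) ^ d - 1) ∣ (b - a) := by
  have h2 : (2 : ZMod (2 ^ k - 1)) ^ k = 1 := by
    have := ZMod.natCast_self (2 ^ k - 1)
    rw [Nat.cast_sub Nat.one_le_two_pow] at this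
    push_cast at this
    exact sub_eq_zero.1 this
  have hu : (2 : ZMod (2 ^ k - 1)) ^ i * 2 ^ (k - i) = 1 := by
    rw [← pow_add, Nat.add_sub_cancel' hi, h2]
  constructor
  · rintro ⟨c, hc⟩
    refine ⟨2 ^ (k - i) * c - b, ?_⟩
    rw [pow_add] at hc
    linear_combination 2 ^ (k - i) * hc - (b * 2 ^ d - a) * hu
  · rintro ⟨c, hc⟩
    refine ⟨2 ^ i * (c + b), ?_⟩
    rw [pow_add]
    linear_combination 2 ^ i * hc

theorem Admissible.two_pow_sub_one_dvd {k : ℕ} {r : ℕ → ℕ} (hr : Admissible k r) {i j : ℕ}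
    (hij : i ≤ j) (hj : j < k) :
    ((2 : ZMod (2 ^ k - 1)) ^ (j - i) - 1) ∣ ((r j : ZMod (2 ^ k - 1)) - r i) := by
  rcases hij.eq_or_lt with rfl | hlt
  · simp
  · rcases hr.2.2 i j hlt hj with h | h
    · exact two_pow_sub_one_dvd_of_coprime h _
    · exact h

variable {F : Type*} [Field F]

theorem orderOf_primitive {k : ℕ} (hF : Nat.card F = 2 ^ k) {ω : Fˣ}
    (hω : ∀ x : Fˣ, x ∈ Subgroup.zpowers ω) : orderOf ω = 2 ^ k - 1 := by
  rw [orderOf_eq_card_of_forall_mem_zpowers hω, card_units_eq hF]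

theorem exists_pow_eq [Finite F] {k : ℕ} (hF : Nat.card F = 2 ^ k) {ω : Fˣ}
    (hω : ∀ x : Fˣ, x ∈ Subgroup.zpowers ω) (a : Fˣ) : ∃ r ≤ 2 ^ k - 2, ω ^ r = a := by
  obtain ⟨n, rfl⟩ := (isOfFinOrder_of_finite _).mem_powers_iff_mem_zpowers.2 (hω a)
  refine ⟨n % orderOf ω, ?_, pow_mod_orderOf ω n⟩
  have := Nat.mod_lt n (orderOf_pos ω)
  rw [orderOf_primitive hF hω] at this ⊢
  omega

theorem eq_zero_of_pow_eq_one {k r : ℕ} (hF : Nat.card F = 2 ^ k) {ω : Fˣ}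
    (hω : ∀ x : Fˣ, x ∈ Subgroup.zpowers ω) (hr : r ≤ 2 ^ k - 2) (h : ω ^ r = 1) : r = 0 := by
  by_contra h0
  have := Nat.le_of_dvd (Nat.pos_of_ne_zero h0) (orderOf_dvd_of_pow_eq_one h)
  rw [orderOf_primitive hF hω] at this
  omega

/-- The equation `ω ^ a * x = ω ^ b * x ^ 2 ^ d` as a divisibility between exponents. -/
theorem exists_pow_mul_eq_iff [Finite F] {k : ℕ} (hF : Nat.card F = 2 ^ k) {ω : Fˣ}
    (hω : ∀ x : Fˣ, x ∈ Subgroup.zpowers ω) (a b d : ℕ) :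
    (∃ x : F, x ≠ 0 ∧ (ω : F) ^ a * x = (ω : F) ^ b * x ^ 2 ^ d) ↔
      ((2 : ZMod (2 ^ k - 1)) ^ d - 1) ∣ ((b : ZMod (2 ^ k - 1)) - a) := by
  have key : ∀ s : ℕ, (ω : F) ^ a * ((ω ^ s : Fˣ) : F) = (ω : F) ^ b * ((ω ^ s : Fˣ) : F) ^ 2 ^ d ↔
      (a : ZMod (2 ^ k - 1)) + s = b + s * 2 ^ d := by
    intro s
    have : ω ^ (a + s) = ω ^ (b + s * 2 ^ d) ↔
        ((a + s : ℕ) : ZMod (2 ^ k - 1)) = ((b + s * 2 ^ d : ℕ) : ZMod (2 ^ k - 1)) := by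
      rw [pow_eq_pow_iff_modEq, orderOf_primitive hF hω, ZMod.natCast_eq_natCast_iff]
    push_cast at this
    rw [← this, Units.ext_iff]
    push_cast
    rw [pow_add, pow_add, pow_mul]
  constructor
  · rintro ⟨x, hx, h⟩
    obtain ⟨s, -, hs⟩ := exists_pow_eq hF hω (Units.mk0 x hx)
    have hs' : x = ((ω ^ s : Fˣ) : F) := by rw [hs, Units.val_mk0]
    rw [hs', key] at h
    exact ⟨-s, by linear_combination -h⟩
  · rintro ⟨c, hc⟩
    -- Lifting -c to a natural number needs a non-zero modulus; for k = 1 it is 1.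
    have : NeZero (2 ^ k - 1) := ⟨by
      have := Nat.one_lt_two_pow (pos_of_card_eq hF).ne'
      omega⟩
    refine ⟨((ω ^ (-c).val : Fˣ) : F), Units.ne_zero _, (key _).2 ?_⟩
    rw [ZMod.natCast_zmod_val]
    linear_combination -hc

end Exponents

/-! ### Triangular matrices -/

section Triangular

variable {F : Type*} [Field F]

theorem mem_Vert_basis_iff {A : GL (Fin 2) F} {α : F} :
    A ∈ Vert ![1, 0] (α • ![1, 0]) ↔ A.val 0 0 = α ∧ A.val 1 0 = 0 := by
  change _ = _ ↔ _
  rw [funext_iff, Fin.forall_fin_two]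
  simp [Matrix.mulVec, dotProduct]

theorem mem_Hor_basis_iff {A : GL (Fin 2) F} {α : F} :
    A ∈ Hor ![0, 1] (α • ![0, 1]) ↔ A.val 1 0 = 0 ∧ A.val 1 1 = α := by
  change _ = _ ↔ _
  rw [funext_iff, Fin.forall_fin_two]
  simp [Matrix.vecMul, dotProduct]

theorem diag_ne_zero_of_lower_eq_zero {A : GL (Fin 2) F} (h : A.val 1 0 = 0) :
    A.val 0 0 ≠ 0 ∧ A.val 1 1 ≠ 0 := by
  have hd := (Matrix.GeneralLinearGroup.det A).ne_zero
  rw [Matrix.GeneralLinearGroup.val_det_apply, Matrix.det_fin_two, h, mul_zero, sub_zero] at hd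
  exact ⟨left_ne_zero_of_mul hd, right_ne_zero_of_mul hd⟩

theorem exists_scalar_mul_upper_iff (ρ : RingAut F) (c : Fˣ) (A : GL (Fin 2) F) :
    (∃ (z : F) (y : Fˣ), A = Matrix.GeneralLinearGroup.scalar (Fin 2) c *
      entrywise F ρ (upper 1 y z)) ↔ A ∈ Vert ![1, 0] ((c : F) • ![1, 0]) := by
  rw [mem_Vert_basis_iff]
  constructor
  · rintro ⟨z, y, rfl⟩
    constructor <;>
      simp [Matrix.mul_apply, coe_entrywise, upper, Matrix.GeneralLinearGroup.mkOfDetNeZero,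
        Matrix.GeneralLinearGroup.scalar]
  · rintro ⟨h00, h10⟩
    have h11 := (diag_ne_zero_of_lower_eq_zero h10).2
    refine ⟨ρ.symm (A.val 0 1 / c), Units.mk0 (ρ.symm (A.val 1 1 / c)) (by simpa using h11), ?_⟩
    ext a b
    rw [Units.val_mul, coe_entrywise]
    fin_cases a <;> fin_cases b <;>
      simp [Matrix.mul_apply, upper, Matrix.GeneralLinearGroup.mkOfDetNeZero,
        Matrix.GeneralLinearGroup.scalar, h00, h10, mul_div_cancel₀]

theorem exists_upper_iff (ρ : RingAut F) (c : Fˣ) (A : GL (Fin 2) F) :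
    (∃ (x : Fˣ) (z : F), A = entrywise F ρ (upper x c z)) ↔
      A ∈ Hor ![0, 1] (ρ c • ![0, 1]) := by
  rw [mem_Hor_basis_iff]
  constructor
  · rintro ⟨x, z, rfl⟩
    constructor <;>
      simp [coe_entrywise, upper, Matrix.GeneralLinearGroup.mkOfDetNeZero]
  · rintro ⟨h10, h11⟩
    have h00 := (diag_ne_zero_of_lower_eq_zero h10).1
    refine ⟨Units.mk0 (ρ.symm (A.val 0 0)) (by simpa using h00), ρ.symm (A.val 0 1), ?_⟩
    ext a b
    rw [coe_entrywise]
    fin_cases a <;> fin_cases b <;>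
      simp [upper, Matrix.GeneralLinearGroup.mkOfDetNeZero, h11, h10]

theorem agree_of_mem_Vert_basis {ρ : RingAut F} {α β x : F} (hx : x ≠ 0) (h : α * x = β * ρ x)
    {A B : GL (Fin 2) F} (hA : A ∈ Vert ![1, 0] (α • ![1, 0]))
    (hB : B ∈ Vert ![1, 0] (β • ![1, 0])) : Agree ρ A B := by
  refine ⟨x • ![1, 0], smul_ne_zero hx (by simp), ?_⟩
  have e : ρ ∘ (![1, 0] : Fin 2 → F) = ![1, 0] := by ext i; fin_cases i <;> simp
  rw [ringAut_comp_smul, Matrix.mulVec_smul, Matrix.mulVec_smul, e, show _ = _ from hA,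
    show _ = _ from hB, smul_smul, smul_smul, mul_comm x, mul_comm (ρ x), h]

/-- The additive map f(y) = A₀₀ y - B₀₀ ρ(y) on the finite field is either bijective or has a
kernel. In the first case the top equation can be solved above the given bottom entry x; in the
second a kernel element y gives the common vector (y, 0). -/
theorem agree_of_mem_Hor_basis [Finite F] {ρ : RingAut F} {α β x : F} (hx : x ≠ 0) (h : α * x = β * ρ x)
    {A B : GL (Fin 2) F} (hA : A ∈ Hor ![0, 1] (α • ![0, 1]))
    (hB : B ∈ Hor ![0, 1] (β • ![0, 1])) : Agree ρ A B := by
  rw [mem_Hor_basis_iff] at hA hB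
  let f : F →+ F := AddMonoidHom.mulLeft (A.val 0 0) -
    (AddMonoidHom.mulLeft (B.val 0 0)).comp (ρ : F →+ F)
  have hf : ∀ y, f y = A.val 0 0 * y - B.val 0 0 * ρ y := fun y => rfl
  by_cases hinj : Function.Injective f
  · obtain ⟨y, hy⟩ := Finite.injective_iff_surjective.1 hinj (B.val 0 1 * ρ x - A.val 0 1 * x)
    rw [hf] at hy
    refine ⟨![y, x], fun h => hx (by simpa using congrFun h 1), ?_⟩
    ext i; fin_cases i
    · simp [Matrix.mulVec, dotProduct, Fin.sum_univ_two]
      linear_combination hy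
    · simpa [Matrix.mulVec, dotProduct, Fin.sum_univ_two, hA, hB] using h
  · rw [injective_iff_map_eq_zero] at hinj
    push Not at hinj
    obtain ⟨y, hy, hy0⟩ := hinj
    rw [hf, sub_eq_zero] at hy
    refine ⟨![y, 0], fun h => hy0 (by simpa using congrFun h 0), ?_⟩
    ext i; fin_cases i
    · simpa [Matrix.mulVec, dotProduct, Fin.sum_univ_two] using hy
    · simp [Matrix.mulVec, dotProduct, Fin.sum_univ_two, hA, hB]

/-- The matrix 1 + n mᵀ has determinant 1 + m ⬝ n = 1. It fixes the vectors killed by m and the rows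
that kill n, which supplies test elements of the identity slice. -/
theorem exists_transvection (n m : Fin 2 → F) (h : m ⬝ᵥ n = 0) :
    ∃ A : GL (Fin 2) F,
      (A : Matrix (Fin 2) (Fin 2) F) = !![1 + n 0 * m 0, n 0 * m 1; n 1 * m 0, 1 + n 1 * m 1] :=
  ⟨Matrix.GeneralLinearGroup.mkOfDetNeZero
    !![1 + n 0 * m 0, n 0 * m 1; n 1 * m 0, 1 + n 1 * m 1] (by
      simp only [dotProduct, Fin.sum_univ_two] at h
      have : (1 + n 0 * m 0) * (1 + n 1 * m 1) - n 0 * m 1 * (n 1 * m 0) = 1 := by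
        linear_combination h
      rw [Matrix.det_fin_two_of, this]
      exact one_ne_zero), rfl⟩

/-- For scalar matrices agreement holds coordinate by coordinate, so any non-zero coordinate solves
the scalar equation. -/
theorem exists_mul_eq_of_agree_scalar {ρ : RingAut F} {a b : Fˣ}
    (h : Agree ρ (Matrix.GeneralLinearGroup.scalar (Fin 2) a)
      (Matrix.GeneralLinearGroup.scalar (Fin 2) b)) :
    ∃ x : F, x ≠ 0 ∧ (a : F) * x = b * ρ x := by
  obtain ⟨w, hw, h⟩ := h
  rw [scalar_mulVec, scalar_mulVec] at h
  obtain ⟨i, hi⟩ := Function.ne_iff.1 hw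
  exact ⟨w i, hi, congrFun h i⟩

end Triangular

/-! ### Sets of vertical and horizontal type through their slices -/

section Types

variable {F : Type*} [Field F] [Finite F] [CharP F 2]

/-- The automorphism `x ↦ x ^ 2 ^ j` as an element of the group generated by the Frobenius. -/
noncomputable abbrev frobPow (F : Type*) [Field F] [Finite F] [CharP F 2] (j : ℕ) :
    Subgroup.zpowers (frob 2 F) :=
  (⟨frob 2 F, Subgroup.mem_zpowers _⟩ : Subgroup.zpowers (frob 2 F)) ^ j

theorem frobPow_apply (j : ℕ) (x : F) : (frobPow F j : RingAut F) x = x ^ 2 ^ j := by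
  rw [Subgroup.coe_pow]
  exact frob_pow_apply j x

theorem frobPow_mul_inv {i j : ℕ} (h : i ≤ j) :
    frobPow F j * (frobPow F i)⁻¹ = frobPow F (j - i) :=
  (pow_sub _ h).symm

theorem mem_V_iff {ω : Fˣ} {i j : ℕ} {A : GL (Fin 2) F} {σ : Subgroup.zpowers (frob 2 F)} :
    (⟨A, σ⟩ : GammaL 2 F) ∈ V 2 ω i j ↔
      σ = frobPow F j ∧ A ∈ Vert ![1, 0] ((ω : F) ^ i • ![1, 0]) := by
  rw [← Units.val_pow_eq_pow_val, ← exists_scalar_mul_upper_iff (frobPow F j : RingAut F)]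
  simp only [← exists_and_left]
  refine exists_congr fun z => exists_congr fun y => ?_
  rw [SemidirectProduct.ext_iff, and_comm]
  generalize ω ^ i = c
  refine and_congr ?_ ?_ <;> simp [ofGL, phiPow]

theorem mem_H_iff {ω : Fˣ} {t j : ℕ} {A : GL (Fin 2) F} {σ : Subgroup.zpowers (frob 2 F)} :
    (⟨A, σ⟩ : GammaL 2 F) ∈ H 2 ω t j ↔
      σ = frobPow F j ∧ A ∈ Hor ![0, 1] ((ω : F) ^ (t * 2 ^ j) • ![0, 1]) := by
  rw [pow_mul, ← frobPow_apply, ← Units.val_pow_eq_pow_val, ← exists_upper_iff]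
  simp only [← exists_and_left]
  refine exists_congr fun x => exists_congr fun z => ?_
  rw [SemidirectProduct.ext_iff, and_comm]
  refine and_congr ?_ ?_ <;> simp [ofGL, phiPow]

theorem eq_iUnion_iff_slice {k : ℕ} (hF : Nat.card F = 2 ^ k) {S : Set (GammaL 2 F)}
    {T : ℕ → Set (GammaL 2 F)} {U : ℕ → Set (GL (Fin 2) F)}
    (hT : ∀ j σ A, (⟨A, σ⟩ : GammaL 2 F) ∈ T j ↔ σ = frobPow F j ∧ A ∈ U j) :
    S = ⋃ j ∈ Finset.range k, T j ↔ ∀ j < k, slice S (frobPow F j) = U j := by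
  have hsl : ∀ j < k, slice (⋃ j ∈ Finset.range k, T j) (frobPow F j) = U j := by
    intro j hj
    ext A
    simp only [mem_slice, Set.mem_iUnion, Finset.mem_range, exists_prop, hT]
    constructor
    · rintro ⟨i, hi, h, hA⟩
      obtain rfl := frob_pow_injOn hF hj hi h
      exact hA
    · exact fun hA => ⟨j, hj, rfl, hA⟩
  constructor
  · rintro rfl
    exact hsl
  · intro h
    refine ext_slice fun σ => ?_
    obtain ⟨j, hj, rfl⟩ := exists_pow_frob_eq hF σ
    rw [h j hj, hsl j hj]

theorem isVerticalType_iff {k : ℕ} (hF : Nat.card F = 2 ^ k) {ω : Fˣ} {S : Set (GammaL 2 F)} :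
    IsVerticalType k ω S ↔ ∃ r : ℕ → ℕ, Admissible k r ∧
      ∀ j < k, slice S (frobPow F j) = Vert ![1, 0] ((ω : F) ^ r j • ![1, 0]) :=
  exists_congr fun _ => and_congr_right fun _ =>
    eq_iUnion_iff_slice hF fun _ _ _ => mem_V_iff

theorem isHorizontalType_iff {k : ℕ} (hF : Nat.card F = 2 ^ k) {ω : Fˣ}
    {S : Set (GammaL 2 F)} :
    IsHorizontalType k ω S ↔ ∃ t : ℕ → ℕ, Admissible k t ∧
      ∀ j < k, slice S (frobPow F j) = Hor ![0, 1] ((ω : F) ^ (t j * 2 ^ j) • ![0, 1]) :=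
  exists_congr fun _ => and_congr_right fun _ =>
    eq_iUnion_iff_slice hF fun _ _ _ => mem_H_iff

theorem isIntersecting_of_agree_le {k : ℕ} (hF : Nat.card F = 2 ^ k) {S : Set (GammaL 2 F)}
    (h : ∀ i j, i ≤ j → j < k → ∀ A ∈ slice S (frobPow F i), ∀ B ∈ slice S (frobPow F j),
      Agree (frobPow F (j - i) : RingAut F) A B) : IsIntersecting (NonzeroVec F) S := by
  have key : ∀ i j, i ≤ j → j < k → ∀ A ∈ slice S (frobPow F i),
      ∀ B ∈ slice S (frobPow F j), ∃ w : NonzeroVec F,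
        (⟨A, frobPow F i⟩ : GammaL 2 F) • w = (⟨B, frobPow F j⟩ : GammaL 2 F) • w := by
    intro i j hij hj A hA B hB
    rw [exists_smul_eq_iff_agree, frobPow_mul_inv hij]
    exact h i j hij hj A hA B hB
  rintro ⟨A, σ⟩ hA ⟨B, τ⟩ hB
  obtain ⟨i, hi, rfl⟩ := exists_pow_frob_eq hF σ
  obtain ⟨j, hj, rfl⟩ := exists_pow_frob_eq hF τ
  rcases le_total i j with hij | hij
  · exact key i j hij hj A hA B hB
  · obtain ⟨w, hw⟩ := key j i hij hi B hB A hA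
    exact ⟨w, hw.symm⟩

theorem isMaximumIntersecting_of_slices {k : ℕ} (hF : Nat.card F = 2 ^ k) {S : Set (GammaL 2 F)}
    (hS : IsIntersecting (NonzeroVec F) S)
    (h : ∀ j < k, (slice S (frobPow F j)).ncard = Nat.card F * (Nat.card F - 1)) :
    IsMaximumIntersecting (NonzeroVec F) S := by
  refine (isMaximumIntersecting_iff hF).2 ⟨hS, ncard_eq_of_slices hF fun σ => ?_⟩
  obtain ⟨j, hj, rfl⟩ := exists_pow_frob_eq hF σ
  exact h j hj

theorem IsVerticalType.isMaximumIntersecting {k : ℕ} (hF : Nat.card F = 2 ^ k) {ω : Fˣ}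
    (hω : ∀ x : Fˣ, x ∈ Subgroup.zpowers ω) {S : Set (GammaL 2 F)}
    (hS : IsVerticalType k ω S) :
    IsMaximumIntersecting (NonzeroVec F) S ∧ 1 ∈ S ∧ S ⊆ upperTriangular 2 F := by
  obtain ⟨r, hr, h⟩ := (isVerticalType_iff hF).1 hS
  refine ⟨isMaximumIntersecting_of_slices hF (isIntersecting_of_agree_le hF ?_) ?_, ?_, ?_⟩
  · intro i j hij hj A hA B hB
    rw [h i (hij.trans_lt hj)] at hA
    rw [h j hj] at hB
    obtain ⟨x, hx, he⟩ := (exists_pow_mul_eq_iff hF hω (r i) (r j) (j - i)).2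
      (hr.two_pow_sub_one_dvd hij hj)
    rw [← frobPow_apply] at he
    exact agree_of_mem_Vert_basis hx he hA hB
  · intro j hj
    rw [h j hj, ncard_Vert (by simp) (smul_ne_zero (pow_ne_zero _ ω.ne_zero) (by simp))]
  · change (1 : GL (Fin 2) F) ∈ slice S (frobPow F 0)
    rw [h 0 (pos_of_card_eq hF), mem_Vert_basis_iff]
    simp [hr.1]
  · rintro ⟨A, σ⟩ hA
    obtain ⟨j, hj, rfl⟩ := exists_pow_frob_eq hF σ
    rw [← mem_slice, h j hj, mem_Vert_basis_iff] at hA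
    exact mem_upperTriangular_iff.2 hA.2

theorem IsHorizontalType.isMaximumIntersecting {k : ℕ} (hF : Nat.card F = 2 ^ k) {ω : Fˣ}
    (hω : ∀ x : Fˣ, x ∈ Subgroup.zpowers ω) {S : Set (GammaL 2 F)}
    (hS : IsHorizontalType k ω S) :
    IsMaximumIntersecting (NonzeroVec F) S ∧ 1 ∈ S ∧ S ⊆ upperTriangular 2 F := by
  obtain ⟨t, ht, h⟩ := (isHorizontalType_iff hF).1 hS
  refine ⟨isMaximumIntersecting_of_slices hF (isIntersecting_of_agree_le hF ?_) ?_, ?_, ?_⟩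
  · intro i j hij hj A hA B hB
    rw [h i (hij.trans_lt hj)] at hA
    rw [h j hj] at hB
    obtain ⟨x, hx, he⟩ := (exists_pow_mul_eq_iff hF hω (t i * 2 ^ i) (t j * 2 ^ j) (j - i)).2 (by
      have := (two_pow_sub_one_dvd_twist_iff i (j - i) (hij.trans hj.le) _ _).2
        (ht.two_pow_sub_one_dvd hij hj)
      rw [Nat.add_sub_cancel' hij] at this
      exact_mod_cast this)
    rw [← frobPow_apply] at he
    exact agree_of_mem_Hor_basis hx he hA hB
  · intro j hj
    rw [h j hj, ncard_Hor (by simp) (smul_ne_zero (pow_ne_zero _ ω.ne_zero) (by simp))]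
  · change (1 : GL (Fin 2) F) ∈ slice S (frobPow F 0)
    rw [h 0 (pos_of_card_eq hF), mem_Hor_basis_iff]
    simp [ht.1]
  · rintro ⟨A, σ⟩ hA
    obtain ⟨j, hj, rfl⟩ := exists_pow_frob_eq hF σ
    rw [← mem_slice, h j hj, mem_Hor_basis_iff] at hA
    exact mem_upperTriangular_iff.2 hA.1

/-! ### Recovering the type from the slices -/

theorem IsIntersecting.exists_mul_eq {S : Set (GammaL 2 F)}
    (hS : IsIntersecting (NonzeroVec F) S) {i j : ℕ} (hij : i ≤ j) {a b : Fˣ}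
    (ha : Matrix.GeneralLinearGroup.scalar (Fin 2) a ∈ slice S (frobPow F i))
    (hb : Matrix.GeneralLinearGroup.scalar (Fin 2) b ∈ slice S (frobPow F j)) :
    ∃ x : F, x ≠ 0 ∧ (a : F) * x = b * x ^ 2 ^ (j - i) := by
  have := isIntersecting_iff_agree.1 hS _ _ _ ha _ hb
  rw [frobPow_mul_inv hij] at this
  simpa only [frobPow_apply] using exists_mul_eq_of_agree_scalar this

/-- The exponents are discrete logarithms of the multipliers. Each slice contains the scalar matrix
of its multiplier, and comparing these scalars yields the congruences. -/
theorem isVerticalType_of_isVertSlice {k : ℕ} (hF : Nat.card F = 2 ^ k) {ω : Fˣ}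
    (hω : ∀ x : Fˣ, x ∈ Subgroup.zpowers ω) {S : Set (GammaL 2 F)}
    (hS : IsIntersecting (NonzeroVec F) S) (h1 : 1 ∈ S) (h : ∀ σ, IsVertSlice S ![1, 0] σ) :
    IsVerticalType k ω S := by
  choose a ha using h
  choose r hr using fun j => exists_pow_eq hF hω (a (frobPow F j))
  have hsl : ∀ j, slice S (frobPow F j) = Vert ![1, 0] ((ω : F) ^ r j • ![1, 0]) := by
    intro j
    have e : ((frobPow F j : RingAut F) : F → F) ∘ ![1, 0] = ![1, 0] := by
      ext i; fin_cases i <;> simp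
    rw [ha, ← (hr j).2, e, Units.val_pow_eq_pow_val]
  have hsc : ∀ j, Matrix.GeneralLinearGroup.scalar (Fin 2) (ω ^ r j) ∈
      slice S (frobPow F j) := by
    intro j
    rw [hsl, Vert, Set.mem_ofPred_eq, scalar_mulVec, Units.val_pow_eq_pow_val]
  refine (isVerticalType_iff hF).2 ⟨r, ⟨?_, fun j _ => (hr j).1, ?_⟩, fun j _ => hsl j⟩
  · apply eq_zero_of_pow_eq_one hF hω (hr 0).1
    have h1' : (1 : GL (Fin 2) F) ∈ slice S (frobPow F 0) := h1
    rw [hsl, mem_Vert_basis_iff] at h1'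
    ext
    simpa using h1'.1.symm
  · intro i j hij _
    -- The congruence holds for every pair, whether or not the gcd is 1.
    right
    rw [← exists_pow_mul_eq_iff hF hω]
    simpa only [Units.val_pow_eq_pow_val] using hS.exists_mul_eq hij.le (hsc i) (hsc j)

theorem isHorizontalType_of_isHorSlice {k : ℕ} (hF : Nat.card F = 2 ^ k) {ω : Fˣ}
    (hω : ∀ x : Fˣ, x ∈ Subgroup.zpowers ω) {S : Set (GammaL 2 F)}
    (hS : IsIntersecting (NonzeroVec F) S) (h1 : 1 ∈ S) (h : ∀ σ, IsHorSlice S ![0, 1] σ) :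
    IsHorizontalType k ω S := by
  choose a ha using h
  -- The inverse automorphism is applied to the multiplier so that ω^(t 2^j), and not ω^t, equals
  -- it.
  choose t ht using fun j => exists_pow_eq hF hω
    (Units.map ((frobPow F j : RingAut F).symm : F →* F) (a (frobPow F j)))
  have hsl : ∀ j, slice S (frobPow F j) = Hor ![0, 1] ((ω : F) ^ (t j * 2 ^ j) • ![0, 1]) := by
    intro j
    have e : ((frobPow F j : RingAut F) : F → F) ∘ ![0, 1] = ![0, 1] := by
      ext i; fin_cases i <;> simp
    have e' : (a (frobPow F j) : F) = (ω : F) ^ (t j * 2 ^ j) := by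
      rw [pow_mul, ← Units.val_pow_eq_pow_val, (ht j).2, ← frobPow_apply]
      exact ((frobPow F j : RingAut F).apply_symm_apply _).symm
    rw [ha, e, e']
  have hsc : ∀ j, Matrix.GeneralLinearGroup.scalar (Fin 2) (ω ^ (t j * 2 ^ j)) ∈
      slice S (frobPow F j) := by
    intro j
    rw [hsl, Hor, Set.mem_ofPred_eq, vecMul_scalar, Units.val_pow_eq_pow_val]
  refine (isHorizontalType_iff hF).2 ⟨t, ⟨?_, fun j _ => (ht j).1, ?_⟩, fun j _ => hsl j⟩
  · apply eq_zero_of_pow_eq_one hF hω (ht 0).1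
    have h1' : (1 : GL (Fin 2) F) ∈ slice S (frobPow F 0) := h1
    rw [hsl, mem_Hor_basis_iff] at h1'
    ext
    simpa using h1'.2.symm
  · intro i j hij hj
    right
    rw [← two_pow_sub_one_dvd_twist_iff i (j - i) (hij.le.trans hj.le),
      Nat.add_sub_cancel' hij.le]
    have := (exists_pow_mul_eq_iff hF hω (t i * 2 ^ i) (t j * 2 ^ j) (j - i)).1 (by
      simpa only [Units.val_pow_eq_pow_val] using hS.exists_mul_eq hij.le (hsc i) (hsc j))
    exact_mod_cast this

theorem IsVertSlice.of_smul {S : Set (GammaL 2 F)} {b : F} (hb : b ≠ 0) {v : Fin 2 → F}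
    {σ : Subgroup.zpowers (frob 2 F)} (h : IsVertSlice S (b • v) σ) : IsVertSlice S v σ := by
  obtain ⟨a, ha⟩ := h
  have hb' : (σ : RingAut F) b ≠ 0 := by simpa using hb
  refine ⟨Units.mk0 (a * b / (σ : RingAut F) b)
    (div_ne_zero (mul_ne_zero a.ne_zero hb) hb'), ?_⟩
  rw [ha, ringAut_comp_smul, smul_smul, Vert_smul hb']
  rfl

theorem IsHorSlice.of_smul {S : Set (GammaL 2 F)} {b : F} (hb : b ≠ 0) {l : Fin 2 → F}
    {σ : Subgroup.zpowers (frob 2 F)} (h : IsHorSlice S (b • l) σ) : IsHorSlice S l σ := by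
  obtain ⟨a, ha⟩ := h
  have hb' : (σ : RingAut F) b ≠ 0 := by simpa using hb
  refine ⟨Units.mk0 (a * (σ : RingAut F) b / b)
    (div_ne_zero (mul_ne_zero a.ne_zero hb') hb), ?_⟩
  rw [ha, ringAut_comp_smul, smul_smul, Hor_smul hb]
  rfl

/-- The identity slice contains the transvections that fix v, or l. One of them has lower left entry
v₁², or -l₀², so triangularity puts v on the first axis, or makes l a multiple of the second
coordinate. -/
theorem IsMaximumIntersecting.type_of_subset_upperTriangular {k : ℕ} (hk : ¬ IsPrimePow k)
    (hF : Nat.card F = 2 ^ k) {ω : Fˣ} (hω : ∀ x : Fˣ, x ∈ Subgroup.zpowers ω)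
    {S : Set (GammaL 2 F)} (hS : IsMaximumIntersecting (NonzeroVec F) S) (h1 : 1 ∈ S)
    (hup : S ⊆ upperTriangular 2 F) : IsVerticalType k ω S ∨ IsHorizontalType k ω S := by
  have h1' : (1 : GL (Fin 2) F) ∈ slice S 1 := h1
  have hup' : ∀ A ∈ slice S 1, A.val 1 0 = 0 := fun A hA => mem_upperTriangular_iff.1 (hup hA)
  rcases hS.isVertSlice_or_isHorSlice hk hF h1 with ⟨v, hv, h⟩ | ⟨l, hl, h⟩
  · left
    refine isVerticalType_of_isVertSlice hF hω hS.1 h1 fun σ => ?_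
    obtain ⟨a, ha⟩ := h 1
    rw [ha] at h1' hup'
    have hav : (a : F) • v = v := by
      rw [← show _ = (a : F) • v from h1', Units.val_one, Matrix.one_mulVec]; rfl
    have hv1 : v 1 = 0 := by
      obtain ⟨A, hA⟩ := exists_transvection v ![v 1, - v 0]
        (by simp [dotProduct, Fin.sum_univ_two]; ring)
      have := hup' A (by
        change _ = _
        rw [hav, hA]
        ext i; fin_cases i <;>
          simp [Matrix.mulVec, dotProduct, Fin.sum_univ_two] <;> ring)
      rw [hA] at this
      simpa using this
    have e : v = v 0 • ![1, 0] := by ext i; fin_cases i <;> simp [hv1]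
    refine IsVertSlice.of_smul (b := v 0) (fun h0 => hv ?_) ?_
    · rw [e, h0, zero_smul]
    · rw [← e]; exact h σ
  · right
    refine isHorizontalType_of_isHorSlice hF hω hS.1 h1 fun σ => ?_
    obtain ⟨a, ha⟩ := h 1
    rw [ha] at h1' hup'
    have hal : (a : F) • (((1 : Subgroup.zpowers (frob 2 F)) : RingAut F) ∘ l) = l := by
      rw [← show _ = (a : F) • _ from h1', Units.val_one, Matrix.vecMul_one]
    have hl0 : l 0 = 0 := by
      obtain ⟨A, hA⟩ := exists_transvection ![l 1, - l 0] l
        (by simp [dotProduct, Fin.sum_univ_two]; ring)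
      have := hup' A (by
        change _ = _
        rw [hal, hA]
        ext i; fin_cases i <;>
          simp [Matrix.vecMul, dotProduct, Fin.sum_univ_two] <;> ring)
      rw [hA] at this
      simpa using this
    have e : l = l 1 • ![0, 1] := by ext i; fin_cases i <;> simp [hl0]
    refine IsHorSlice.of_smul (b := l 1) (fun h0 => hl ?_) ?_
    · rw [e, h0, zero_smul]
    · rw [← e]; exact h σ

end Types
end SemilinearEKR

/-! ### The theorem -/

theorem theorem3 (k : ℕ) (hk : ¬ IsPrimePow k) (F : Type*) [Field F] [Finite F] [CharP F 2]
    (hF : Nat.card F = 2 ^ k) :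
    SemilinearEKR.HasEKR (SemilinearEKR.GammaL 2 F) (SemilinearEKR.NonzeroVec F) ∧
    IsGreatest {n : ℕ | ∃ S : Set (SemilinearEKR.GammaL 2 F),
        SemilinearEKR.IsIntersecting (SemilinearEKR.NonzeroVec F) S ∧ S.ncard = n}
      (k * 2 ^ k * (2 ^ k - 1)) ∧
    ∀ ω : Fˣ, (∀ x : Fˣ, x ∈ Subgroup.zpowers ω) →
      (∀ S : Set (SemilinearEKR.GammaL 2 F),
        SemilinearEKR.IsMaximumIntersecting (SemilinearEKR.NonzeroVec F) S → ∀ f ∈ S,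
          ∃ g : SemilinearEKR.GammaL 2 F,
            SemilinearEKR.IsVerticalType k ω ((fun s => g * (f⁻¹ * s) * g⁻¹) '' S) ∨
            SemilinearEKR.IsHorizontalType k ω ((fun s => g * (f⁻¹ * s) * g⁻¹) '' S)) ∧
      (∀ S : Set (SemilinearEKR.GammaL 2 F),
        (SemilinearEKR.IsMaximumIntersecting (SemilinearEKR.NonzeroVec F) S ∧
            1 ∈ S ∧ S ⊆ SemilinearEKR.upperTriangular 2 F) ↔
          (SemilinearEKR.IsVerticalType k ω S ∨ SemilinearEKR.IsHorizontalType k ω S)) := by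
  have hsize : k * 2 ^ k * (2 ^ k - 1) = k * (Nat.card F * (Nat.card F - 1)) := by
    rw [hF, mul_assoc]
  refine ⟨fun S hS w => ?_, ⟨?_, ?_⟩, fun ω hω => ⟨fun S hS f hf => ?_, fun S => ⟨?_, ?_⟩⟩⟩
  · rw [← SetLike.coe_sort_coe, Nat.card_coe_set_eq, SemilinearEKR.ncard_stabilizer hF]
    exact hS.ncard_le hF
  · rw [hsize]
    exact ⟨_, SemilinearEKR.isIntersecting_stabilizer _,
      SemilinearEKR.ncard_stabilizer hF (⟨![1, 0], by simp⟩ : SemilinearEKR.NonzeroVec F)⟩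
  · rintro _ ⟨S, hS, rfl⟩
    rw [hsize]
    exact hS.ncard_le hF
  · obtain ⟨g, hg⟩ := hS.exists_conj_subset_upperTriangular hk hF hf
    exact ⟨g, (hS.image_conj hF f g).type_of_subset_upperTriangular hk hF hω
      ⟨f, hf, by simp⟩ hg⟩
  · rintro ⟨hS, h1, hup⟩
    exact hS.type_of_subset_upperTriangular hk hF hω h1 hup
  · rintro (h | h)
    · exact h.isMaximumIntersecting hF hω
    · exact h.isMaximumIntersecting hF hω
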